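/- Let $\mathsf B$ and $\mathsf X$ be categories with (chosen) finite products, with terminal objects $I_{\mathsf B}$, $I_{\mathsf X}$, and let $P\colon\mathsf X\to\mathsf B$ be a cartesian monoidal opfibration: $P$ is a Grothendieck opfibration, $P$ strictly preserves finite products ($P(I_{\mathsf X})=I_{\mathsf B}$, $P(X\times Y)=P(X)\times P(Y)$, and $P$ sends product projections to product projections), and the product of two $P$-cocartesian arrows is $P$-cocartesian. Fix a cleavage of $P$ (a choice of cocartesian liftings) and let $F\colon\mathsf B\to\mathbf{CAT}$ be the associated pseudofunctor, sending $A$ to the fibre $F(A)=P^{-1}(A)$ and an arrow $f$ to the change of base functor $f_*$. For an internal monoid $(A,m,e)$ in $\mathsf B$ the category $F(A)$ carries the induced monoidal structure with tensor product $x\otimes y=m_*(x\times y)$ and unit object $e_*(I_{\mathsf X})$; for a morphism of monoids $f$, the functor $f_*$ is strong monoidal; this gives a pseudofunctor $\mathrm{Mon}(F)$ from $\mathsf{Mon}(\mathsf B)$ to the 2-category of monoidal categories, strong monoidal functors and monoidal natural transformations. If the monoids are commutative, the symmetry of $\times$ makes these structures symmetric, which gives a pseudofunctor $\mathrm{CMon}(F)$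 from $\mathsf{CMon}(\mathsf B)$ to the 2-category of symmetric monoidal categories, symmetric strong monoidal functors and monoidal natural transformations. A (symmetric) 2-group is a (symmetric) monoidal groupoid in which every object $x$ is weakly invertible: there is an object $y$ with $x\otimes y\cong I\cong y\otimes x$. Let $2\text{-}\mathbb{G}\mathrm p$ (resp. $\mathbb{SCG}$) be the full sub-2-category of 2-groups (resp. symmetric 2-groups) in that of monoidal (resp. symmetric monoidal) categories. Suppose that all fibres of $P$ are groupoids. Then $F$ lifts to internal groups and to internal abelian groups: 1. there is a pseudofunctor $G\colon\mathsf{Gp}(\mathsf B)\to 2\text{-}\mathbb{G}\mathrm p$ such that $U\circ G=F\circ U$ as pseudofunctors $\mathsf{Gp}(\mathsf B)\to\mathbf{CAT}$, where the $U$'s are the forgetful functors, and whose composite with the inclusion of 2-groups in monoidal categories is the restriction of $\mathrm{Mon}(F)$ to $\mathsf{Gp}(\mathsf B)$; 2. there is a pseudofunctor $K\colon\mathsf{Ab}(\mathsf B)\to\mathbb{SCG}$ such that $U\circ K=F\circ U$ as pseudofunctors $\mathsf{Ab}(\mathsf B)\to\mathbf{CAT}$, and whose composite with the inclusion of symmetric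 2-groups in symmetric monoidal categories is the restriction of $\mathrm{CMon}(F)$ to $\mathsf{Ab}(\mathsf B)$. -/

import Mathlib

open CategoryTheory

universe v₁ u₁ v₂ u₂ v u

namespace GroupalOpfib

open MonoidalCategory CartesianMonoidalCategory MonObj

/-! ### Opfibrations, cleavages and the associated pseudofunctor -/

section Opfibration

variable {B : Type u₁} [Category.{v₁} B] {E : Type u₂} [Category.{v₂} E]

/-- The inclusion of a fibre of `P` into the total category. -/
abbrev incl {P : E ⥤ B} {S : B} : P.Fiber S ⥤ E := Functor.Fiber.fiberInclusion

/-- `P` is a (Grothendieck) opfibration: every arrow out of `P x` has a cocartesian lifting at `x`.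
Cocartesian is meant in the usual strong sense. -/
def IsOpfibration (P : E ⥤ B) : Prop :=
  ∀ (x : E) {T : B} (f : P.obj x ⟶ T), ∃ (y : E) (φ : x ⟶ y), P.IsStronglyCocartesian f φ

/-- A cleavage of an opfibration: a choice, for each `f : S ⟶ T` in the base and each `x` in the
fibre over `S`, of a cocartesian lifting `x ⟶ f_* x` of `f`. -/
structure Opcleavage (P : E ⥤ B) where
  pushObj : ∀ {S T : B}, (S ⟶ T) → P.Fiber S → P.Fiber T
  liftTo : ∀ {S T : B} (f : S ⟶ T) (x : P.Fiber S), incl.obj x ⟶ incl.obj (pushObj f x)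
  isStronglyCocartesian : ∀ {S T : B} (f : S ⟶ T) (x : P.Fiber S),
    P.IsStronglyCocartesian f (liftTo f x)

attribute [instance] Opcleavage.isStronglyCocartesian

variable {P : E ⥤ B}

theorem isHomLift_of_eq {S T : B} {x y : E} {f g : S ⟶ T} {φ : x ⟶ y} (h : f = g)
    (hφ : P.IsHomLift f φ) : P.IsHomLift g φ := h ▸ hφ

theorem isStronglyCocartesian_of_eq {S T : B} {x y : E} {f g : S ⟶ T} {φ : x ⟶ y} (h : f = g)
    (hφ : P.IsStronglyCocartesian f φ) : P.IsStronglyCocartesian g φ := h ▸ hφ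

instance isHomLift_id {S : B} (x : P.Fiber S) : P.IsHomLift (𝟙 S) (𝟙 (incl.obj x)) := (𝟙 x : x ⟶ x).2

/-- Two vertical maps that agree after precomposition with a cocartesian arrow are equal. -/
theorem fiber_ext {S T : B} (f : S ⟶ T) {x : E} {a b : P.Fiber T} (φ : x ⟶ incl.obj a)
    (hφ : P.IsStronglyCocartesian f φ) {g h : a ⟶ b} (w : φ ≫ incl.map g = φ ≫ incl.map h) : g = h :=
  Functor.Fiber.hom_ext (Functor.IsStronglyCocartesian.ext P f φ (𝟙 T) w)

/-- The vertical map out of the codomain of a cocartesian arrow given by its universal property. -/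
noncomputable def descend {S T : B} (f : S ⟶ T) {x : E} {a b : P.Fiber T} (φ : x ⟶ incl.obj a)
    (hφ : P.IsStronglyCocartesian f φ) (ψ : x ⟶ incl.obj b) (hψ : P.IsHomLift f ψ) : a ⟶ b :=
  ⟨Functor.IsCocartesian.map (b := incl.obj a) (b' := incl.obj b) P f φ ψ,
    Functor.IsCocartesian.map_isHomLift (b := incl.obj a) (b' := incl.obj b) P f φ ψ⟩

@[simp]
theorem fac_descend {S T : B} (f : S ⟶ T) {x : E} {a b : P.Fiber T} (φ : x ⟶ incl.obj a)
    (hφ : P.IsStronglyCocartesian f φ) (ψ : x ⟶ incl.obj b) (hψ : P.IsHomLift f ψ) :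
    φ ≫ incl.map (descend f φ hφ ψ hψ) = ψ :=
  Functor.IsCocartesian.fac (b := incl.obj a) (b' := incl.obj b) P f φ ψ

@[simp]
theorem fac_descend_assoc {S T : B} (f : S ⟶ T) {x : E} {a b : P.Fiber T} (φ : x ⟶ incl.obj a)
    (hφ : P.IsStronglyCocartesian f φ) (ψ : x ⟶ incl.obj b) (hψ : P.IsHomLift f ψ)
    {Z : E} (k : incl.obj b ⟶ Z) :
    φ ≫ incl.map (descend f φ hφ ψ hψ) ≫ k = ψ ≫ k := by
  simpa only [Category.assoc, Category.id_comp] using congrArg (fun t => t ≫ k) (fac_descend f φ hφ ψ hψ)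

/-- The vertical comparison isomorphism between two cocartesian arrows over the same arrow. -/
@[simps] noncomputable def compareIso {S T : B} (f : S ⟶ T) {x : E} {a b : P.Fiber T}
    (φ : x ⟶ incl.obj a) (hφ : P.IsStronglyCocartesian f φ)
    (ψ : x ⟶ incl.obj b) (hψ : P.IsStronglyCocartesian f ψ) : a ≅ b where
  hom := descend f φ hφ ψ hψ.toIsHomLift
  inv := descend f ψ hψ φ hφ.toIsHomLift
  hom_inv_id := fiber_ext f φ hφ (by simp)
  inv_hom_id := fiber_ext f ψ hψ (by simp)

theorem toCatHom_eqToHom_app {C D : Type u₂} [Category.{v₂} C] [Category.{v₂} D] (F G : C ⥤ D)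
    (h : F.toCatHom = G.toCatHom) (x : C) (h' : F.obj x = G.obj x) :
    (eqToHom h).toNatTrans.app x = eqToHom h' := by
  obtain rfl : F = G := congrArg Cat.Hom.toFunctor h
  rfl

namespace Opcleavage

variable (c : Opcleavage P)

/-- The change of base functor `f_*` between fibres. -/
noncomputable def push {S T : B} (f : S ⟶ T) : P.Fiber S ⥤ P.Fiber T where
  obj := c.pushObj f
  map {x y} g := descend f (c.liftTo f x) (c.isStronglyCocartesian f x) (incl.map g ≫ c.liftTo f y)
    (isHomLift_of_eq (Category.id_comp f) inferInstance)
  map_id x := fiber_ext f (c.liftTo f x) (c.isStronglyCocartesian f x) (by simp)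
  map_comp g h := fiber_ext f (c.liftTo f _) (c.isStronglyCocartesian f _) (by simp)

/-- The chosen cocartesian lifting `x ⟶ f_* x` of `f`. -/
def lift {S T : B} (f : S ⟶ T) (x : P.Fiber S) : incl.obj x ⟶ incl.obj ((c.push f).obj x) :=
  c.liftTo f x

instance isStronglyCocartesian_lift {S T : B} (f : S ⟶ T) (x : P.Fiber S) :
    P.IsStronglyCocartesian f (c.lift f x) :=
  c.isStronglyCocartesian f x

@[simp]
theorem lift_push_map {S T : B} (f : S ⟶ T) {x y : P.Fiber S} (g : x ⟶ y) :
    c.lift f x ≫ incl.map ((c.push f).map g) = incl.map g ≫ c.lift f y :=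
  fac_descend (b := (c.push f).obj y) f (c.liftTo f x) (c.isStronglyCocartesian f x)
    (incl.map g ≫ c.lift f y) (isHomLift_of_eq (Category.id_comp f) inferInstance)

@[simp]
theorem lift_push_map_assoc {S T : B} (f : S ⟶ T) {x y : P.Fiber S} (g : x ⟶ y)
    {Z : E} (k : incl.obj ((c.push f).obj y) ⟶ Z) :
    c.lift f x ≫ incl.map ((c.push f).map g) ≫ k = incl.map g ≫ c.lift f y ≫ k := by
  simpa only [Category.assoc, Category.id_comp] using congrArg (fun t => t ≫ k) (c.lift_push_map f g)

/-- The canonical isomorphism `(1_S)_* ≅ 1`. -/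
noncomputable def pushId (S : B) : c.push (𝟙 S) ≅ 𝟭 (P.Fiber S) :=
  NatIso.ofComponents
    (fun x => compareIso (b := x) (𝟙 S) (c.lift (𝟙 S) x) inferInstance (𝟙 (incl.obj x))
      inferInstance)
    (fun {x y} g => fiber_ext (𝟙 S) (c.lift (𝟙 S) x) inferInstance (by simp))

@[simp]
theorem lift_pushId_hom {S : B} (x : P.Fiber S) :
    c.lift (𝟙 S) x ≫ incl.map ((c.pushId S).hom.app x) = 𝟙 (incl.obj x) :=
  fac_descend (b := x) (𝟙 S) (c.lift (𝟙 S) x) inferInstance _ inferInstance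

@[simp]
theorem lift_pushId_hom_assoc {S : B} (x : P.Fiber S)
    {Z : E} (k : incl.obj x ⟶ Z) :
    c.lift (𝟙 S) x ≫ incl.map ((c.pushId S).hom.app x) ≫ k = k := by
  simpa only [Category.assoc, Category.id_comp] using congrArg (fun t => t ≫ k) (c.lift_pushId_hom x)

/-- The canonical isomorphism `(f ≫ g)_* ≅ f_* ⋙ g_*`. -/
noncomputable def pushComp {S T U : B} (f : S ⟶ T) (g : T ⟶ U) :
    c.push (f ≫ g) ≅ c.push f ⋙ c.push g :=
  NatIso.ofComponents
    (fun x => compareIso (b := (c.push g).obj ((c.push f).obj x)) (f ≫ g) (c.lift (f ≫ g) x)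
      inferInstance (c.lift f x ≫ c.lift g ((c.push f).obj x)) inferInstance)
    (fun {x y} h => fiber_ext (f ≫ g) (c.lift (f ≫ g) x) inferInstance (by simp))

@[simp]
theorem lift_pushComp_hom {S T U : B} (f : S ⟶ T) (g : T ⟶ U) (x : P.Fiber S) :
    c.lift (f ≫ g) x ≫ incl.map ((c.pushComp f g).hom.app x) =
      c.lift f x ≫ c.lift g ((c.push f).obj x) :=
  fac_descend (b := (c.push g).obj ((c.push f).obj x)) (f ≫ g) (c.lift (f ≫ g) x) inferInstance _
    inferInstance

@[simp]
theorem lift_pushComp_hom_assoc {S T U : B} (f : S ⟶ T) (g : T ⟶ U) (x : P.Fiber S)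
    {Z : E} (k : incl.obj ((c.push g).obj ((c.push f).obj x)) ⟶ Z) :
    c.lift (f ≫ g) x ≫ incl.map ((c.pushComp f g).hom.app x) ≫ k =
      c.lift f x ≫ c.lift g ((c.push f).obj x) ≫ k := by
  simpa only [Category.assoc, Category.id_comp] using congrArg (fun t => t ≫ k) (c.lift_pushComp_hom f g x)

@[simp]
theorem lift_pushComp_inv {S T U : B} (f : S ⟶ T) (g : T ⟶ U) (x : P.Fiber S) :
    c.lift f x ≫ c.lift g ((c.push f).obj x) ≫ incl.map ((c.pushComp f g).inv.app x) =
      c.lift (f ≫ g) x := by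
  rw [← c.lift_pushComp_hom_assoc, ← Functor.map_comp]
  simp

@[simp]
theorem lift_pushComp_inv_assoc {S T U : B} (f : S ⟶ T) (g : T ⟶ U) (x : P.Fiber S)
    {Z : E} (k : incl.obj ((c.push (f ≫ g)).obj x) ⟶ Z) :
    c.lift f x ≫ c.lift g ((c.push f).obj x) ≫ incl.map ((c.pushComp f g).inv.app x) ≫ k =
      c.lift (f ≫ g) x ≫ k := by
  simpa only [Category.assoc, Category.id_comp] using congrArg (fun t => t ≫ k) (c.lift_pushComp_inv f g x)

theorem lift_eqToHom {S T : B} {f g : S ⟶ T} (h : f = g) (x : P.Fiber S)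
    (h' : (c.push f).obj x = (c.push g).obj x) :
    c.lift f x ≫ incl.map (eqToHom h') = c.lift g x := by
  subst h
  simp

theorem pushComp_assoc {S T U V : B} (f : S ⟶ T) (g : T ⟶ U) (h : U ⟶ V) (x : P.Fiber S) :
    (c.pushComp (f ≫ g) h).hom.app x ≫ (c.push h).map ((c.pushComp f g).hom.app x) ≫
      (c.pushComp g h).inv.app ((c.push f).obj x) ≫ (c.pushComp f (g ≫ h)).inv.app x =
    eqToHom (by rw [Category.assoc]) := by
  apply fiber_ext ((f ≫ g) ≫ h) (c.lift ((f ≫ g) ≫ h) x) inferInstance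
  rw [c.lift_eqToHom (Category.assoc f g h)]
  simp

theorem pushComp_id_left {S T : B} (f : S ⟶ T) (x : P.Fiber S) :
    (c.pushComp (𝟙 S) f).hom.app x ≫ (c.push f).map ((c.pushId S).hom.app x) =
    eqToHom (by simp) := by
  apply fiber_ext (𝟙 S ≫ f) (c.lift (𝟙 S ≫ f) x) inferInstance
  rw [c.lift_eqToHom (Category.id_comp f)]
  simp

theorem pushComp_id_right {S T : B} (f : S ⟶ T) (x : P.Fiber S) :
    (c.pushComp f (𝟙 T)).hom.app x ≫ (c.pushId T).hom.app ((c.push f).obj x) =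
    eqToHom (by simp) := by
  apply fiber_ext (f ≫ 𝟙 T) (c.lift (f ≫ 𝟙 T) x) inferInstance
  rw [c.lift_eqToHom (Category.comp_id f)]
  simp

/-- The pseudofunctor associated with a cloven opfibration: it sends `S` to the fibre over `S` and
`f` to the change of base functor `f_*`. -/
noncomputable def pseudofunctor : Pseudofunctor (LocallyDiscrete B) Cat.{v₂, u₂} :=
  LocallyDiscrete.mkPseudofunctor
    (fun S => Cat.of (P.Fiber S))
    (fun f => (c.push f).toCatHom)
    (fun S => Cat.Hom.isoMk (c.pushId S))
    (fun f g => Cat.Hom.isoMk (c.pushComp f g))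
    (fun f g h => by
      ext x
      refine (Eq.trans ?_ (c.pushComp_assoc f g h x)).trans (toCatHom_eqToHom_app _ _ _ x _).symm
      exact congrArg (fun t => (c.pushComp (f ≫ g) h).hom.app x ≫
        (c.push h).map ((c.pushComp f g).hom.app x) ≫ t) (Category.id_comp
          ((c.pushComp g h).inv.app ((c.push f).obj x) ≫ (c.pushComp f (g ≫ h)).inv.app x)))
    (fun f => by
      ext x
      refine (Eq.trans ?_ (c.pushComp_id_left f x)).trans (toCatHom_eqToHom_app _ _ _ x _).symm
      exact congrArg (fun t => (c.pushComp (𝟙 _) f).hom.app x ≫ t)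
        (Category.comp_id ((c.push f).map ((c.pushId _).hom.app x))))
    (fun f => by
      ext x
      refine (Eq.trans ?_ (c.pushComp_id_right f x)).trans (toCatHom_eqToHom_app _ _ _ x _).symm
      exact congrArg (fun t => (c.pushComp f (𝟙 _)).hom.app x ≫ t)
        (Category.comp_id ((c.pushId _).hom.app ((c.push f).obj x))))

end Opcleavage

end Opfibration

/-! ### Cartesian monoidal opfibrations and the monoidal structure on fibres over monoids -/

section Cartesian

variable {B : Type u₁} [Category.{v₁} B] [CartesianMonoidalCategory B]
  {E : Type u₂} [Category.{v₂} E] [CartesianMonoidalCategory E]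

/-- `P` is a cartesian monoidal opfibration: `E` and `B` have finite products, `P` is an opfibration
that strictly preserves the (chosen) finite products, and products of cocartesian arrows are
cocartesian. The projections of `x ⊗ y` are required to lie over those of `P x ⊗ P y`; this includes
`P (x ⊗ y) = P x ⊗ P y`. -/
class IsCartesianMonoidalOpfibration (P : E ⥤ B) : Prop where
  isOpfibration : IsOpfibration P
  obj_unit : P.obj (𝟙_ E) = 𝟙_ B
  isHomLift_fst : ∀ x y : E, P.IsHomLift (fst (P.obj x) (P.obj y)) (fst x y)
  isHomLift_snd : ∀ x y : E, P.IsHomLift (snd (P.obj x) (P.obj y)) (snd x y)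
  tensor_cocartesian : ∀ {x x' y y' : E} (φ : x ⟶ x') (ψ : y ⟶ y'),
    P.IsStronglyCocartesian (P.map φ) φ → P.IsStronglyCocartesian (P.map ψ) ψ →
      P.IsStronglyCocartesian (P.map (φ ⊗ₘ ψ)) (φ ⊗ₘ ψ)

variable {P : E ⥤ B} [hP : IsCartesianMonoidalOpfibration P]

theorem map_fst_fac (x y : E) (h : P.obj (x ⊗ y) = P.obj x ⊗ P.obj y) :
    eqToHom h ≫ fst (P.obj x) (P.obj y) = P.map (fst x y) := by
  have := hP.isHomLift_fst x y
  rw [IsHomLift.fac' P (fst (P.obj x) (P.obj y)) (fst x y)]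
  simp

theorem map_snd_fac (x y : E) (h : P.obj (x ⊗ y) = P.obj x ⊗ P.obj y) :
    eqToHom h ≫ snd (P.obj x) (P.obj y) = P.map (snd x y) := by
  have := hP.isHomLift_snd x y
  rw [IsHomLift.fac' P (snd (P.obj x) (P.obj y)) (snd x y)]
  simp

theorem obj_tensor (x y : E) : P.obj (x ⊗ y) = P.obj x ⊗ P.obj y :=
  have := hP.isHomLift_fst x y
  IsHomLift.domain_eq P (fst (P.obj x) (P.obj y)) (fst x y)

theorem isHomLift_lift {S T U : B} {x y z : E} (f : S ⟶ T) (g : S ⟶ U) (φ : x ⟶ y) (ψ : x ⟶ z)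
    [P.IsHomLift f φ] [P.IsHomLift g ψ] :
    P.IsHomLift (CartesianMonoidalCategory.lift f g) (CartesianMonoidalCategory.lift φ ψ) := by
  obtain rfl := IsHomLift.domain_eq P f φ
  obtain rfl := IsHomLift.codomain_eq P f φ
  obtain rfl := IsHomLift.codomain_eq P g ψ
  obtain rfl := IsHomLift.eq_of_isHomLift P f φ
  obtain rfl := IsHomLift.eq_of_isHomLift P g ψ
  refine IsHomLift.of_fac P _ _ rfl (obj_tensor y z) ?_
  ext
  · simp [map_fst_fac, ← Functor.map_comp]
  · simp [map_snd_fac, ← Functor.map_comp]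

instance isHomLift_fst' {S T : B} (x : P.Fiber S) (y : P.Fiber T) :
    P.IsHomLift (fst S T) (fst (incl.obj x) (incl.obj y)) := by
  obtain ⟨x, rfl⟩ := x
  obtain ⟨y, rfl⟩ := y
  exact hP.isHomLift_fst x y

instance isHomLift_snd' {S T : B} (x : P.Fiber S) (y : P.Fiber T) :
    P.IsHomLift (snd S T) (snd (incl.obj x) (incl.obj y)) := by
  obtain ⟨x, rfl⟩ := x
  obtain ⟨y, rfl⟩ := y
  exact hP.isHomLift_snd x y

instance isHomLift_tensorHom {S S' T T' : B} {x x' y y' : E} (f : S ⟶ S') (g : T ⟶ T')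
    (φ : x ⟶ x') (ψ : y ⟶ y') [P.IsHomLift f φ] [P.IsHomLift g ψ] :
    P.IsHomLift (f ⊗ₘ g) (φ ⊗ₘ ψ) := by
  obtain rfl := IsHomLift.domain_eq P f φ
  obtain rfl := IsHomLift.domain_eq P g ψ
  have := hP.isHomLift_fst x y
  have := hP.isHomLift_snd x y
  have h := isHomLift_lift (P := P) (fst (P.obj x) (P.obj y) ≫ f) (snd (P.obj x) (P.obj y) ≫ g)
    (fst x y ≫ φ) (snd x y ≫ ψ)
  simpa using h

instance isStronglyCocartesian_tensorHom {S S' T T' : B} {x x' y y' : E} (f : S ⟶ S') (g : T ⟶ T')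
    (φ : x ⟶ x') (ψ : y ⟶ y') [P.IsStronglyCocartesian f φ] [P.IsStronglyCocartesian g ψ] :
    P.IsStronglyCocartesian (f ⊗ₘ g) (φ ⊗ₘ ψ) := by
  obtain rfl := IsHomLift.domain_eq P f φ
  obtain rfl := IsHomLift.codomain_eq P f φ
  obtain rfl := IsHomLift.domain_eq P g ψ
  obtain rfl := IsHomLift.codomain_eq P g ψ
  obtain rfl := IsHomLift.eq_of_isHomLift P f φ
  obtain rfl := IsHomLift.eq_of_isHomLift P g ψ
  have h := hP.tensor_cocartesian φ ψ inferInstance inferInstance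
  have h' : P.IsHomLift (P.map φ ⊗ₘ P.map ψ) (φ ⊗ₘ ψ) := inferInstance
  refine ⟨fun {b'} g τ hτ => ?_⟩
  have e := IsHomLift.fac' P (P.map φ ⊗ₘ P.map ψ) (φ ⊗ₘ ψ)
  have hτ' : P.IsHomLift (P.map (φ ⊗ₘ ψ) ≫ eqToHom (obj_tensor x' y') ≫ g) τ := by
    rw [e]
    simpa using hτ
  obtain ⟨χ, ⟨h₁, h₂⟩, h₃⟩ := h.universal_property' (eqToHom (obj_tensor x' y') ≫ g) τ
  refine ⟨χ, ⟨by simpa using h₁, h₂⟩, fun χ' hχ' => h₃ χ' ⟨by simpa using hχ'.1, hχ'.2⟩⟩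

instance isHomLift_whiskerRight {S S' T : B} {x x' : E} (f : S ⟶ S') (φ : x ⟶ x') (y : P.Fiber T)
    [P.IsHomLift f φ] : P.IsHomLift (f ▷ T) (φ ▷ incl.obj y) := by
  rw [← tensorHom_id, ← tensorHom_id]
  infer_instance

instance isHomLift_whiskerLeft {S S' T : B} {x x' : E} (f : S ⟶ S') (φ : x ⟶ x') (y : P.Fiber T)
    [P.IsHomLift f φ] : P.IsHomLift (T ◁ f) (incl.obj y ◁ φ) := by
  rw [← id_tensorHom, ← id_tensorHom]
  infer_instance

instance isStronglyCocartesian_whiskerRight {S S' T : B} {x x' : E} (f : S ⟶ S') (φ : x ⟶ x')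
    (y : P.Fiber T) [P.IsStronglyCocartesian f φ] :
    P.IsStronglyCocartesian (f ▷ T) (φ ▷ incl.obj y) := by
  rw [← tensorHom_id, ← tensorHom_id]
  infer_instance

instance isStronglyCocartesian_whiskerLeft {S S' T : B} {x x' : E} (f : S ⟶ S') (φ : x ⟶ x')
    (y : P.Fiber T) [P.IsStronglyCocartesian f φ] :
    P.IsStronglyCocartesian (T ◁ f) (incl.obj y ◁ φ) := by
  rw [← id_tensorHom, ← id_tensorHom]
  infer_instance

/-- The product in `E` of objects over `S` and `T`, as an object over `S ⊗ T`. This is the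
laxity functor `F S × F T ⥤ F (S ⊗ T)` on objects. -/
def prodObj {S T : B} (x : P.Fiber S) (y : P.Fiber T) : P.Fiber (S ⊗ T) :=
  Functor.Fiber.mk (a := incl.obj x ⊗ incl.obj y)
    (IsHomLift.domain_eq P (fst S T) (fst (incl.obj x) (incl.obj y)))

/-- The terminal object of `E`, as an object over the terminal object of `B`. -/
def unitObj (P : E ⥤ B) [hP : IsCartesianMonoidalOpfibration P] : P.Fiber (𝟙_ B) :=
  Functor.Fiber.mk (a := 𝟙_ E) hP.obj_unit

instance isHomLift_associator {S T U : B} (x : P.Fiber S) (y : P.Fiber T) (z : P.Fiber U) :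
    P.IsHomLift (α_ S T U).hom (α_ (incl.obj x) (incl.obj y) (incl.obj z)).hom := by
  have h1 : P.IsHomLift (fst (S ⊗ T) U) (fst (incl.obj x ⊗ incl.obj y) (incl.obj z)) :=
    isHomLift_fst' (prodObj x y) z
  have h2 : P.IsHomLift (snd (S ⊗ T) U) (snd (incl.obj x ⊗ incl.obj y) (incl.obj z)) :=
    isHomLift_snd' (prodObj x y) z
  have h3 := isHomLift_lift (P := P) (fst (S ⊗ T) U ≫ snd S T) (snd (S ⊗ T) U)
    (fst (incl.obj x ⊗ incl.obj y) (incl.obj z) ≫ snd (incl.obj x) (incl.obj y)) (snd _ _)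
  have h := isHomLift_lift (P := P) (fst (S ⊗ T) U ≫ fst S T)
    (CartesianMonoidalCategory.lift (fst (S ⊗ T) U ≫ snd S T) (snd (S ⊗ T) U))
    (fst (incl.obj x ⊗ incl.obj y) (incl.obj z) ≫ fst (incl.obj x) (incl.obj y))
    (CartesianMonoidalCategory.lift
      (fst (incl.obj x ⊗ incl.obj y) (incl.obj z) ≫ snd _ _) (snd _ _))
  convert h using 1 <;> cat_disch

instance isHomLift_leftUnitor {S : B} (x : P.Fiber S) :
    P.IsHomLift (λ_ S).hom (λ_ (incl.obj x)).hom := by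
  have h : P.IsHomLift (snd (𝟙_ B) S) (snd (𝟙_ E) (incl.obj x)) := isHomLift_snd' (unitObj P) x
  simpa [snd_def] using h

instance isHomLift_rightUnitor {S : B} (x : P.Fiber S) :
    P.IsHomLift (ρ_ S).hom (ρ_ (incl.obj x)).hom := by
  have h : P.IsHomLift (fst S (𝟙_ B)) (fst (incl.obj x) (𝟙_ E)) := isHomLift_fst' x (unitObj P)
  simpa [fst_def] using h

instance isHomLift_braiding [BraidedCategory B] [BraidedCategory E] {S T : B}
    (x : P.Fiber S) (y : P.Fiber T) :
    P.IsHomLift (β_ S T).hom (β_ (incl.obj x) (incl.obj y)).hom := by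
  have h := isHomLift_lift (P := P) (snd S T) (fst S T)
    (snd (incl.obj x) (incl.obj y)) (fst (incl.obj x) (incl.obj y))
  convert h using 1 <;> cat_disch

namespace Opcleavage

variable (c : Opcleavage P)

section Monoid

variable {A : B} [MonObj A]

/-- The tensor product on the fibre over a monoid `A`: `x ⊗ y := μ_* (x × y)`. -/
noncomputable def tens (x y : P.Fiber A) : P.Fiber A := (c.push μ[A]).obj (prodObj x y)

/-- The cocartesian arrow `x × y ⟶ x ⊗ y` over the multiplication of `A`. -/
noncomputable def q (x y : P.Fiber A) : incl.obj x ⊗ incl.obj y ⟶ incl.obj (c.tens x y) :=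
  c.lift μ[A] (prodObj x y)

instance isStronglyCocartesian_q (x y : P.Fiber A) : P.IsStronglyCocartesian μ[A] (c.q x y) :=
  c.isStronglyCocartesian_lift μ[A] (prodObj x y)

variable (A) in
/-- The unit object of the fibre over a monoid `A`: `η_* 1`. -/
noncomputable def tensUnit : P.Fiber A := (c.push η[A]).obj (unitObj P)

variable (A) in
/-- The cocartesian arrow from the terminal object to the unit object, over the unit of `A`. -/
noncomputable def u : 𝟙_ E ⟶ incl.obj (c.tensUnit A) := c.lift η[A] (unitObj P)

instance isStronglyCocartesian_u : P.IsStronglyCocartesian η[A] (c.u A) :=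
  c.isStronglyCocartesian_lift η[A] (unitObj P)

/-- The tensor product of vertical arrows, induced by their product. -/
noncomputable def tensMap {x x' y y' : P.Fiber A} (f : x ⟶ x') (g : y ⟶ y') :
    c.tens x y ⟶ c.tens x' y' :=
  descend μ[A] (c.q x y) inferInstance ((incl.map f ⊗ₘ incl.map g) ≫ c.q x' y')
    (isHomLift_of_eq (f := (𝟙 A ⊗ₘ 𝟙 A) ≫ μ[A]) (by simp) inferInstance)

@[simp]
theorem q_tensMap {x x' y y' : P.Fiber A} (f : x ⟶ x') (g : y ⟶ y') :
    c.q x y ≫ incl.map (c.tensMap f g) = (incl.map f ⊗ₘ incl.map g) ≫ c.q x' y' :=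
  fac_descend _ _ _ _ _

@[simp]
theorem q_tensMap_assoc {x x' y y' : P.Fiber A} (f : x ⟶ x') (g : y ⟶ y')
    {Z : E} (k : incl.obj (c.tens x' y') ⟶ Z) :
    c.q x y ≫ incl.map (c.tensMap f g) ≫ k = (incl.map f ⊗ₘ incl.map g) ≫ c.q x' y' ≫ k := by
  simpa only [Category.assoc, Category.id_comp] using congrArg (fun t => t ≫ k) (c.q_tensMap f g)

/-- The cocartesian arrow `(x × y) × z ⟶ (x ⊗ y) ⊗ z`. -/
noncomputable def q₃ (x y z : P.Fiber A) :
    (incl.obj x ⊗ incl.obj y) ⊗ incl.obj z ⟶ incl.obj (c.tens (c.tens x y) z) :=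
  c.q x y ▷ incl.obj z ≫ c.q (c.tens x y) z

instance isStronglyCocartesian_q₃ (x y z : P.Fiber A) :
    P.IsStronglyCocartesian (μ[A] ▷ A ≫ μ[A]) (c.q₃ x y z) := by
  unfold q₃; infer_instance

/-- The cocartesian arrow `(x × y) × z ≅ x × (y × z) ⟶ x ⊗ (y ⊗ z)`. -/
noncomputable def q₃' (x y z : P.Fiber A) :
    (incl.obj x ⊗ incl.obj y) ⊗ incl.obj z ⟶ incl.obj (c.tens x (c.tens y z)) :=
  (α_ _ _ _).hom ≫ incl.obj x ◁ c.q y z ≫ c.q x (c.tens y z)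

theorem isStronglyCocartesian_q₃' (x y z : P.Fiber A) :
    P.IsStronglyCocartesian (μ[A] ▷ A ≫ μ[A]) (c.q₃' x y z) := by
  unfold q₃'
  exact isStronglyCocartesian_of_eq (MonObj.mul_assoc A).symm inferInstance

/-- The associator, induced by that of the product. -/
noncomputable def tensAssoc (x y z : P.Fiber A) :
    c.tens (c.tens x y) z ≅ c.tens x (c.tens y z) :=
  compareIso (μ[A] ▷ A ≫ μ[A]) (c.q₃ x y z) inferInstance (c.q₃' x y z)
    (c.isStronglyCocartesian_q₃' x y z)

@[simp]
theorem q_tensAssoc (x y z : P.Fiber A) :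
    c.q x y ▷ incl.obj z ≫ c.q (c.tens x y) z ≫ incl.map (c.tensAssoc x y z).hom =
      (α_ _ _ _).hom ≫ incl.obj x ◁ c.q y z ≫ c.q x (c.tens y z) := by
  rw [← Category.assoc]
  exact fac_descend (μ[A] ▷ A ≫ μ[A]) (c.q₃ x y z) inferInstance (c.q₃' x y z)
    (c.isStronglyCocartesian_q₃' x y z).toIsHomLift

@[simp]
theorem q_tensAssoc_assoc (x y z : P.Fiber A)
    {Z : E} (k : incl.obj (c.tens x (c.tens y z)) ⟶ Z) :
    c.q x y ▷ incl.obj z ≫ c.q (c.tens x y) z ≫ incl.map (c.tensAssoc x y z).hom ≫ k =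
      (α_ (incl.obj x) (incl.obj y) (incl.obj z)).hom ≫ incl.obj x ◁ c.q y z ≫
        c.q x (c.tens y z) ≫ k := by
  simpa only [Category.assoc, Category.id_comp] using congrArg (fun t => t ≫ k) (c.q_tensAssoc x y z)

instance isStronglyCocartesian_uq (x : P.Fiber A) :
    P.IsStronglyCocartesian (η[A] ▷ A ≫ μ[A])
      (c.u A ▷ incl.obj x ≫ c.q (c.tensUnit A) x) := inferInstance

instance isStronglyCocartesian_qu (x : P.Fiber A) :
    P.IsStronglyCocartesian (A ◁ η[A] ≫ μ[A])
      (incl.obj x ◁ c.u A ≫ c.q x (c.tensUnit A)) := inferInstance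

/-- The left unitor, induced by the projection `1 × x ≅ x`. -/
noncomputable def tensLeftUnitor (x : P.Fiber A) : c.tens (c.tensUnit A) x ≅ x :=
  compareIso (η[A] ▷ A ≫ μ[A]) (c.u A ▷ incl.obj x ≫ c.q (c.tensUnit A) x) inferInstance
    (λ_ (incl.obj x)).hom (isStronglyCocartesian_of_eq (MonObj.one_mul A).symm inferInstance)

@[simp]
theorem q_tensLeftUnitor (x : P.Fiber A) :
    c.u A ▷ incl.obj x ≫ c.q (c.tensUnit A) x ≫ incl.map (c.tensLeftUnitor x).hom =
      (λ_ (incl.obj x)).hom := by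
  rw [← Category.assoc]
  exact fac_descend (η[A] ▷ A ≫ μ[A]) _ (c.isStronglyCocartesian_uq x) _
    (isHomLift_of_eq (MonObj.one_mul A).symm inferInstance)

@[simp]
theorem q_tensLeftUnitor_assoc (x : P.Fiber A)
    {Z : E} (k : incl.obj x ⟶ Z) :
    c.u A ▷ incl.obj x ≫ c.q (c.tensUnit A) x ≫ incl.map (c.tensLeftUnitor x).hom ≫ k =
      (λ_ (incl.obj x)).hom ≫ k := by
  simpa only [Category.assoc, Category.id_comp] using congrArg (fun t => t ≫ k) (c.q_tensLeftUnitor x)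

/-- The right unitor, induced by the projection `x × 1 ≅ x`. -/
noncomputable def tensRightUnitor (x : P.Fiber A) : c.tens x (c.tensUnit A) ≅ x :=
  compareIso (A ◁ η[A] ≫ μ[A]) (incl.obj x ◁ c.u A ≫ c.q x (c.tensUnit A)) inferInstance
    (ρ_ (incl.obj x)).hom (isStronglyCocartesian_of_eq (MonObj.mul_one A).symm inferInstance)

@[simp]
theorem q_tensRightUnitor (x : P.Fiber A) :
    incl.obj x ◁ c.u A ≫ c.q x (c.tensUnit A) ≫ incl.map (c.tensRightUnitor x).hom =
      (ρ_ (incl.obj x)).hom := by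
  rw [← Category.assoc]
  exact fac_descend (A ◁ η[A] ≫ μ[A]) _ (c.isStronglyCocartesian_qu x) _
    (isHomLift_of_eq (MonObj.mul_one A).symm inferInstance)

@[simp]
theorem q_tensRightUnitor_assoc (x : P.Fiber A)
    {Z : E} (k : incl.obj x ⟶ Z) :
    incl.obj x ◁ c.u A ≫ c.q x (c.tensUnit A) ≫ incl.map (c.tensRightUnitor x).hom ≫ k =
      (ρ_ (incl.obj x)).hom ≫ k := by
  simpa only [Category.assoc, Category.id_comp] using congrArg (fun t => t ≫ k) (c.q_tensRightUnitor x)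

theorem tensMap_id (x y : P.Fiber A) : c.tensMap (𝟙 x) (𝟙 y) = 𝟙 (c.tens x y) :=
  fiber_ext μ[A] (c.q x y) inferInstance (by simp)

theorem tensMap_comp {x x' x'' y y' y'' : P.Fiber A} (f : x ⟶ x') (g : y ⟶ y')
    (f' : x' ⟶ x'') (g' : y' ⟶ y'') :
    c.tensMap f g ≫ c.tensMap f' g' = c.tensMap (f ≫ f') (g ≫ g') :=
  fiber_ext μ[A] (c.q x y) inferInstance (by simp [tensorHom_comp_tensorHom_assoc])

@[simp]
theorem q_tensMap_id_left (x : P.Fiber A) {y y' : P.Fiber A} (g : y ⟶ y') :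
    c.q x y ≫ incl.map (c.tensMap (𝟙 x) g) = incl.obj x ◁ incl.map g ≫ c.q x y' := by
  simp

@[simp]
theorem q_tensMap_id_left_assoc (x : P.Fiber A) {y y' : P.Fiber A} (g : y ⟶ y')
    {Z : E} (k : incl.obj (c.tens x y') ⟶ Z) :
    c.q x y ≫ incl.map (c.tensMap (𝟙 x) g) ≫ k = incl.obj x ◁ incl.map g ≫ c.q x y' ≫ k := by
  simpa only [Category.assoc, Category.id_comp] using congrArg (fun t => t ≫ k) (c.q_tensMap_id_left x g)

@[simp]
theorem q_tensMap_id_right {x x' : P.Fiber A} (f : x ⟶ x') (y : P.Fiber A) :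
    c.q x y ≫ incl.map (c.tensMap f (𝟙 y)) = incl.map f ▷ incl.obj y ≫ c.q x' y := by
  simp

@[simp]
theorem q_tensMap_id_right_assoc {x x' : P.Fiber A} (f : x ⟶ x') (y : P.Fiber A)
    {Z : E} (k : incl.obj (c.tens x' y) ⟶ Z) :
    c.q x y ≫ incl.map (c.tensMap f (𝟙 y)) ≫ k = incl.map f ▷ incl.obj y ≫ c.q x' y ≫ k := by
  simpa only [Category.assoc, Category.id_comp] using congrArg (fun t => t ≫ k) (c.q_tensMap_id_right f y)

theorem q₃_tensMap {x x' y y' z z' : P.Fiber A} (f : x ⟶ x') (g : y ⟶ y') (h : z ⟶ z') :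
    c.q₃ x y z ≫ incl.map (c.tensMap (c.tensMap f g) h) =
      ((incl.map f ⊗ₘ incl.map g) ⊗ₘ incl.map h) ≫ c.q₃ x' y' z' := by
  simp only [q₃, Category.assoc, q_tensMap, ← tensorHom_id, tensorHom_comp_tensorHom_assoc,
    Category.id_comp, Category.comp_id]

theorem q₃_tensMap_assoc {x x' y y' z z' : P.Fiber A} (f : x ⟶ x') (g : y ⟶ y') (h : z ⟶ z')
    {Z : E} (k : incl.obj (c.tens (c.tens x' y') z') ⟶ Z) :
    c.q₃ x y z ≫ incl.map (c.tensMap (c.tensMap f g) h) ≫ k =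
      ((incl.map f ⊗ₘ incl.map g) ⊗ₘ incl.map h) ≫ c.q₃ x' y' z' ≫ k := by
  simpa only [Category.assoc, Category.id_comp] using congrArg (fun t => t ≫ k) (c.q₃_tensMap f g h)

theorem q₃'_tensMap {x x' y y' z z' : P.Fiber A} (f : x ⟶ x') (g : y ⟶ y') (h : z ⟶ z') :
    c.q₃' x y z ≫ incl.map (c.tensMap f (c.tensMap g h)) =
      ((incl.map f ⊗ₘ incl.map g) ⊗ₘ incl.map h) ≫ c.q₃' x' y' z' := by
  simp only [q₃', Category.assoc, q_tensMap, ← id_tensorHom, tensorHom_comp_tensorHom_assoc,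
    Category.id_comp, Category.comp_id, associator_naturality_assoc]

theorem q₃'_tensMap_assoc {x x' y y' z z' : P.Fiber A} (f : x ⟶ x') (g : y ⟶ y') (h : z ⟶ z')
    {Z : E} (k : incl.obj (c.tens x' (c.tens y' z')) ⟶ Z) :
    c.q₃' x y z ≫ incl.map (c.tensMap f (c.tensMap g h)) ≫ k =
      ((incl.map f ⊗ₘ incl.map g) ⊗ₘ incl.map h) ≫ c.q₃' x' y' z' ≫ k := by
  simpa only [Category.assoc, Category.id_comp] using congrArg (fun t => t ≫ k) (c.q₃'_tensMap f g h)

theorem q₃_tensAssoc (x y z : P.Fiber A) :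
    c.q₃ x y z ≫ incl.map (c.tensAssoc x y z).hom = c.q₃' x y z := by
  simp [q₃, q₃']

theorem q₃_tensAssoc_assoc (x y z : P.Fiber A)
    {Z : E} (k : incl.obj (c.tens x (c.tens y z)) ⟶ Z) :
    c.q₃ x y z ≫ incl.map (c.tensAssoc x y z).hom ≫ k = c.q₃' x y z ≫ k := by
  simpa only [Category.assoc, Category.id_comp] using congrArg (fun t => t ≫ k) (c.q₃_tensAssoc x y z)

theorem tensAssoc_naturality {x x' y y' z z' : P.Fiber A} (f : x ⟶ x') (g : y ⟶ y')
    (h : z ⟶ z') :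
    c.tensMap (c.tensMap f g) h ≫ (c.tensAssoc x' y' z').hom =
      (c.tensAssoc x y z).hom ≫ c.tensMap f (c.tensMap g h) := by
  apply fiber_ext (μ[A] ▷ A ≫ μ[A]) (c.q₃ x y z) inferInstance
  simp only [Functor.map_comp, q₃_tensMap_assoc, q₃_tensAssoc, q₃_tensAssoc_assoc, q₃'_tensMap]

theorem tensLeftUnitor_naturality {x y : P.Fiber A} (f : x ⟶ y) :
    c.tensMap (𝟙 (c.tensUnit A)) f ≫ (c.tensLeftUnitor y).hom =
      (c.tensLeftUnitor x).hom ≫ f := by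
  apply fiber_ext _ _ (c.isStronglyCocartesian_uq x)
  simp [← whisker_exchange_assoc]

theorem tensRightUnitor_naturality {x y : P.Fiber A} (f : x ⟶ y) :
    c.tensMap f (𝟙 (c.tensUnit A)) ≫ (c.tensRightUnitor y).hom =
      (c.tensRightUnitor x).hom ≫ f := by
  apply fiber_ext _ _ (c.isStronglyCocartesian_qu x)
  simp [whisker_exchange_assoc]

theorem tens_triangle (x y : P.Fiber A) :
    (c.tensAssoc x (c.tensUnit A) y).hom ≫ c.tensMap (𝟙 x) (c.tensLeftUnitor y).hom =
      c.tensMap (c.tensRightUnitor x).hom (𝟙 y) := by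
  apply fiber_ext ((A ◁ η[A]) ▷ A ≫ μ[A] ▷ A ≫ μ[A])
    ((incl.obj x ◁ c.u A) ▷ incl.obj y ≫ c.q₃ x (c.tensUnit A) y) inferInstance
  have h1 : incl.obj x ◁ c.u A ▷ incl.obj y ≫ incl.obj x ◁ c.q (c.tensUnit A) y ≫
      incl.obj x ◁ incl.map (c.tensLeftUnitor y).hom = incl.obj x ◁ (λ_ (incl.obj y)).hom := by
    simp only [← MonoidalCategory.whiskerLeft_comp, q_tensLeftUnitor]
  have h2 : (incl.obj x ◁ c.u A) ▷ incl.obj y ≫ c.q x (c.tensUnit A) ▷ incl.obj y ≫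
      incl.map (c.tensRightUnitor x).hom ▷ incl.obj y = (ρ_ (incl.obj x)).hom ▷ incl.obj y := by
    simp only [← comp_whiskerRight, q_tensRightUnitor]
  simp only [q₃, Functor.map_comp, Category.assoc, q_tensAssoc_assoc, q_tensMap_id_left,
    q_tensMap_id_right, associator_naturality_middle_assoc]
  rw [reassoc_of% h1, reassoc_of% h2, triangle_assoc]

theorem tens_pentagon (w x y z : P.Fiber A) :
    c.tensMap (c.tensAssoc w x y).hom (𝟙 z) ≫ (c.tensAssoc w (c.tens x y) z).hom ≫
        c.tensMap (𝟙 w) (c.tensAssoc x y z).hom =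
      (c.tensAssoc (c.tens w x) y z).hom ≫ (c.tensAssoc w x (c.tens y z)).hom := by
  apply fiber_ext ((μ[A] ▷ A) ▷ A ≫ μ[A] ▷ A ≫ μ[A])
    ((c.q w x ▷ incl.obj y) ▷ incl.obj z ≫ c.q₃ (c.tens w x) y z) inferInstance
  have h1 : c.q w x ▷ incl.obj y ▷ incl.obj z ≫ c.q (c.tens w x) y ▷ incl.obj z ≫
      incl.map (c.tensAssoc w x y).hom ▷ incl.obj z =
      (α_ _ _ _).hom ▷ incl.obj z ≫ (incl.obj w ◁ c.q x y) ▷ incl.obj z ≫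
        c.q w (c.tens x y) ▷ incl.obj z := by
    simp only [← comp_whiskerRight, q_tensAssoc]
  have h2 : incl.obj w ◁ c.q x y ▷ incl.obj z ≫ incl.obj w ◁ c.q (c.tens x y) z ≫
      incl.obj w ◁ incl.map (c.tensAssoc x y z).hom =
      incl.obj w ◁ (α_ _ _ _).hom ≫ incl.obj w ◁ (incl.obj x ◁ c.q y z) ≫
        incl.obj w ◁ c.q x (c.tens y z) := by
    simp only [← MonoidalCategory.whiskerLeft_comp, q_tensAssoc]
  simp only [q₃, Functor.map_comp, Category.assoc, q_tensAssoc_assoc, q_tensMap_id_right_assoc]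
  rw [reassoc_of% h1, q_tensAssoc_assoc, q_tensMap_id_left, associator_naturality_middle_assoc,
    reassoc_of% h2, pentagon_assoc, associator_naturality_left_assoc,
    ← whisker_exchange_assoc, q_tensAssoc, associator_naturality_right_assoc]

variable (A) in
/-- The data of the monoidal structure on the fibre over a monoid `A`. -/
@[reducible] noncomputable def fiberMonoidalStruct : MonoidalCategoryStruct (P.Fiber A) where
  tensorObj := c.tens
  whiskerLeft x _ _ g := c.tensMap (𝟙 x) g
  whiskerRight f y := c.tensMap f (𝟙 y)
  tensorHom := c.tensMap
  tensorUnit := c.tensUnit A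
  associator := c.tensAssoc
  leftUnitor := c.tensLeftUnitor
  rightUnitor := c.tensRightUnitor

variable (A) in
/-- The monoidal structure on the fibre over a monoid `A` in the base: the tensor product is
`x ⊗ y = μ_* (x × y)`, the unit object is `η_* 1`. -/
@[reducible] noncomputable def fiberMonoidal : MonoidalCategory (P.Fiber A) :=
  letI := c.fiberMonoidalStruct A
  MonoidalCategory.ofTensorHom
    (id_tensorHom_id := c.tensMap_id)
    (id_tensorHom := fun _ _ _ _ => rfl)
    (tensorHom_id := fun _ _ => rfl)
    (tensorHom_comp_tensorHom := fun f₁ f₂ g₁ g₂ => c.tensMap_comp f₁ f₂ g₁ g₂)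
    (associator_naturality := c.tensAssoc_naturality)
    (leftUnitor_naturality := c.tensLeftUnitor_naturality)
    (rightUnitor_naturality := c.tensRightUnitor_naturality)
    (pentagon := c.tens_pentagon)
    (triangle := c.tens_triangle)

section Braided

variable [BraidedCategory B] [BraidedCategory E] [IsCommMonObj A]

theorem isStronglyCocartesian_braid_q (x y : P.Fiber A) :
    P.IsStronglyCocartesian μ[A] ((β_ (incl.obj x) (incl.obj y)).hom ≫ c.q y x) :=
  isStronglyCocartesian_of_eq (IsCommMonObj.mul_comm A) inferInstance

/-- The braiding on the fibre over a commutative monoid, induced by the symmetry of the product. -/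
noncomputable def tensBraid (x y : P.Fiber A) : c.tens x y ≅ c.tens y x :=
  compareIso μ[A] (c.q x y) inferInstance ((β_ (incl.obj x) (incl.obj y)).hom ≫ c.q y x)
    (c.isStronglyCocartesian_braid_q x y)

@[simp]
theorem q_tensBraid (x y : P.Fiber A) :
    c.q x y ≫ incl.map (c.tensBraid x y).hom = (β_ (incl.obj x) (incl.obj y)).hom ≫ c.q y x :=
  fac_descend μ[A] (c.q x y) inferInstance _ (c.isStronglyCocartesian_braid_q x y).toIsHomLift

@[simp]
theorem q_tensBraid_assoc (x y : P.Fiber A)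
    {Z : E} (k : incl.obj (c.tens y x) ⟶ Z) :
    c.q x y ≫ incl.map (c.tensBraid x y).hom ≫ k =
      (β_ (incl.obj x) (incl.obj y)).hom ≫ c.q y x ≫ k := by
  simpa only [Category.assoc, Category.id_comp] using congrArg (fun t => t ≫ k) (c.q_tensBraid x y)

theorem tensBraid_naturality {x x' y y' : P.Fiber A} (f : x ⟶ x') (g : y ⟶ y') :
    c.tensMap f g ≫ (c.tensBraid x' y').hom = (c.tensBraid x y).hom ≫ c.tensMap g f :=
  fiber_ext μ[A] (c.q x y) inferInstance (by simp)

theorem tensBraid_symm (x y : P.Fiber A) :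
    (c.tensBraid x y).hom ≫ (c.tensBraid y x).hom = 𝟙 (c.tens x y) :=
  fiber_ext μ[A] (c.q x y) inferInstance (by simp)

theorem tens_hexagon (x y z : P.Fiber A) :
    (c.tensAssoc x y z).hom ≫ (c.tensBraid x (c.tens y z)).hom ≫ (c.tensAssoc y z x).hom =
      c.tensMap (c.tensBraid x y).hom (𝟙 z) ≫ (c.tensAssoc y x z).hom ≫
        c.tensMap (𝟙 y) (c.tensBraid x z).hom := by
  apply fiber_ext (μ[A] ▷ A ≫ μ[A]) (c.q₃ x y z) inferInstance
  have h1 : c.q x y ▷ incl.obj z ≫ incl.map (c.tensBraid x y).hom ▷ incl.obj z =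
      (β_ _ _).hom ▷ incl.obj z ≫ c.q y x ▷ incl.obj z := by
    simp only [← comp_whiskerRight, q_tensBraid]
  have h2 : incl.obj y ◁ c.q x z ≫ incl.obj y ◁ incl.map (c.tensBraid x z).hom =
      incl.obj y ◁ (β_ _ _).hom ≫ incl.obj y ◁ c.q z x := by
    simp only [← MonoidalCategory.whiskerLeft_comp, q_tensBraid]
  simp only [q₃, Functor.map_comp, Category.assoc, q_tensAssoc_assoc, q_tensBraid_assoc,
    q_tensMap_id_right_assoc]
  rw [reassoc_of% h1, q_tensAssoc_assoc, q_tensMap_id_left, reassoc_of% h2,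
    BraidedCategory.braiding_naturality_right_assoc, q_tensAssoc]
  simp

theorem tens_hexagon_reverse (x y z : P.Fiber A) :
    (c.tensAssoc x y z).inv ≫ (c.tensBraid (c.tens x y) z).hom ≫ (c.tensAssoc z x y).inv =
      c.tensMap (𝟙 x) (c.tensBraid y z).hom ≫ (c.tensAssoc x z y).inv ≫
        c.tensMap (c.tensBraid x z).hom (𝟙 y) := by
  have h := c.tens_hexagon z x y
  have h1 : ((c.tensAssoc z x y).hom ≫ (c.tensBraid z (c.tens x y)).hom ≫
      (c.tensAssoc x y z).hom) ≫ (c.tensAssoc x y z).inv ≫ (c.tensBraid (c.tens x y) z).hom ≫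
        (c.tensAssoc z x y).inv = 𝟙 _ := by
    simp [reassoc_of% c.tensBraid_symm z (c.tens x y)]
  have h2 : (c.tensMap (𝟙 x) (c.tensBraid y z).hom ≫ (c.tensAssoc x z y).inv ≫
        c.tensMap (c.tensBraid x z).hom (𝟙 y)) ≫ c.tensMap (c.tensBraid z x).hom (𝟙 y) ≫
        (c.tensAssoc x z y).hom ≫ c.tensMap (𝟙 x) (c.tensBraid z y).hom = 𝟙 _ := by
    have e1 : c.tensMap (c.tensBraid x z).hom (𝟙 y) ≫ c.tensMap (c.tensBraid z x).hom (𝟙 y) =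
        𝟙 _ := by
      rw [c.tensMap_comp, c.tensBraid_symm, Category.comp_id, c.tensMap_id]
    have e2 : c.tensMap (𝟙 x) (c.tensBraid y z).hom ≫ c.tensMap (𝟙 x) (c.tensBraid z y).hom =
        𝟙 _ := by
      rw [c.tensMap_comp, c.tensBraid_symm, Category.comp_id, c.tensMap_id]
    simp [reassoc_of% e1, e2]
  rw [← h] at h2
  have h3 := congrArg (fun t => t ≫ (c.tensAssoc x y z).inv ≫ (c.tensBraid (c.tens x y) z).hom ≫
        (c.tensAssoc z x y).inv) h2
  simp only [Category.id_comp] at h3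
  rw [← h3, Category.assoc _ (_ ≫ _) , h1, Category.comp_id]

variable (A) in
/-- The symmetric monoidal structure on the fibre over a commutative monoid `A` in the base. -/
@[reducible] noncomputable def fiberSymmetric :
    letI := c.fiberMonoidal A
    SymmetricCategory (P.Fiber A) :=
  letI := c.fiberMonoidal A
  { braiding := c.tensBraid
    braiding_naturality_right := fun x _ _ g => c.tensBraid_naturality (𝟙 x) g
    braiding_naturality_left := fun f z => c.tensBraid_naturality f (𝟙 z)
    hexagon_forward := c.tens_hexagon
    hexagon_reverse := c.tens_hexagon_reverse
    symmetry := c.tensBraid_symm }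

end Braided

section MonHom

variable {A' : B} [MonObj A'] (f : A ⟶ A') [IsMonHom f]

theorem isStronglyCocartesian_u_lift :
    P.IsStronglyCocartesian η[A'] (c.u A ≫ c.lift f (c.tensUnit A)) :=
  isStronglyCocartesian_of_eq (IsMonHom.one_hom f) inferInstance

/-- The comparison of unit objects along `f_*`. -/
noncomputable def pushε : c.tensUnit A' ≅ (c.push f).obj (c.tensUnit A) :=
  compareIso η[A'] (c.u A') inferInstance (c.u A ≫ c.lift f (c.tensUnit A))
    (c.isStronglyCocartesian_u_lift f)

@[simp]
theorem u_pushε : c.u A' ≫ incl.map (c.pushε f).hom = c.u A ≫ c.lift f (c.tensUnit A) :=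
  fac_descend η[A'] (c.u A') inferInstance _ (c.isStronglyCocartesian_u_lift f).toIsHomLift

@[simp]
theorem u_pushε_assoc
    {Z : E} (k : incl.obj ((c.push f).obj (c.tensUnit A)) ⟶ Z) :
    c.u A' ≫ incl.map (c.pushε f).hom ≫ k = c.u A ≫ c.lift f (c.tensUnit A) ≫ k := by
  simpa only [Category.assoc, Category.id_comp] using congrArg (fun t => t ≫ k) (c.u_pushε f)

theorem isStronglyCocartesian_q_lift (x y : P.Fiber A) :
    P.IsStronglyCocartesian ((f ⊗ₘ f) ≫ μ[A']) (c.q x y ≫ c.lift f (c.tens x y)) :=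
  isStronglyCocartesian_of_eq (IsMonHom.mul_hom f) inferInstance

/-- The comparison of tensor products along `f_*`. -/
noncomputable def pushμ (x y : P.Fiber A) :
    c.tens ((c.push f).obj x) ((c.push f).obj y) ≅ (c.push f).obj (c.tens x y) :=
  compareIso ((f ⊗ₘ f) ≫ μ[A']) ((c.lift f x ⊗ₘ c.lift f y) ≫ c.q _ _) inferInstance
    (c.q x y ≫ c.lift f (c.tens x y)) (c.isStronglyCocartesian_q_lift f x y)

@[simp]
theorem q_pushμ (x y : P.Fiber A) :
    (c.lift f x ⊗ₘ c.lift f y) ≫ c.q _ _ ≫ incl.map (c.pushμ f x y).hom =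
      c.q x y ≫ c.lift f (c.tens x y) := by
  rw [← Category.assoc]
  exact fac_descend ((f ⊗ₘ f) ≫ μ[A']) _ inferInstance _
    (c.isStronglyCocartesian_q_lift f x y).toIsHomLift

@[simp]
theorem q_pushμ_assoc (x y : P.Fiber A)
    {Z : E} (k : incl.obj ((c.push f).obj (c.tens x y)) ⟶ Z) :
    (c.lift f x ⊗ₘ c.lift f y) ≫ c.q _ _ ≫ incl.map (c.pushμ f x y).hom ≫ k =
      c.q x y ≫ c.lift f (c.tens x y) ≫ k := by
  simpa only [Category.assoc, Category.id_comp] using congrArg (fun t => t ≫ k) (c.q_pushμ f x y)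

theorem pushμ_naturality {x x' y y' : P.Fiber A} (g : x ⟶ x') (h : y ⟶ y') :
    c.tensMap ((c.push f).map g) ((c.push f).map h) ≫ (c.pushμ f x' y').hom =
      (c.pushμ f x y).hom ≫ (c.push f).map (c.tensMap g h) := by
  apply fiber_ext ((f ⊗ₘ f) ≫ μ[A']) ((c.lift f x ⊗ₘ c.lift f y) ≫ c.q _ _) inferInstance
  simp only [Functor.map_comp, Category.assoc, q_tensMap_assoc, q_pushμ_assoc, lift_push_map,
    tensorHom_comp_tensorHom_assoc]
  simp only [← tensorHom_comp_tensorHom_assoc, q_pushμ]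

theorem pushμ_associativity (x y z : P.Fiber A) :
    c.tensMap (c.pushμ f x y).hom (𝟙 ((c.push f).obj z)) ≫ (c.pushμ f (c.tens x y) z).hom ≫
        (c.push f).map (c.tensAssoc x y z).hom =
      (c.tensAssoc _ _ _).hom ≫ c.tensMap (𝟙 ((c.push f).obj x)) (c.pushμ f y z).hom ≫
        (c.pushμ f x (c.tens y z)).hom := by
  apply fiber_ext (((f ⊗ₘ f) ⊗ₘ f) ≫ μ[A'] ▷ A' ≫ μ[A'])
    (((c.lift f x ⊗ₘ c.lift f y) ⊗ₘ c.lift f z) ≫ c.q₃ _ _ _) inferInstance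
  have h1 : ((c.lift f x ⊗ₘ c.lift f y) ⊗ₘ c.lift f z) ≫ c.q _ _ ▷ _ ≫
      incl.map (c.pushμ f x y).hom ▷ _ = c.q x y ▷ incl.obj z ≫ (c.lift f _ ⊗ₘ c.lift f z) := by
    simp only [← tensorHom_id, tensorHom_comp_tensorHom, q_pushμ, Category.comp_id,
      Category.id_comp]
  have h2 : (c.lift f x ⊗ₘ (c.lift f y ⊗ₘ c.lift f z)) ≫ _ ◁ c.q _ _ ≫
      _ ◁ incl.map (c.pushμ f y z).hom = incl.obj x ◁ c.q y z ≫ (c.lift f x ⊗ₘ c.lift f _) := by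
    simp only [← id_tensorHom, tensorHom_comp_tensorHom, q_pushμ, Category.comp_id,
      Category.id_comp]
  simp only [q₃, Functor.map_comp, Category.assoc, q_tensMap_id_right_assoc, q_tensAssoc_assoc,
    q_tensMap_id_left_assoc]
  rw [reassoc_of% h1, q_pushμ_assoc, lift_push_map, q_tensAssoc_assoc, associator_naturality_assoc,
    reassoc_of% h2, q_pushμ]

theorem pushμ_left_unitality (x : P.Fiber A) :
    (c.tensLeftUnitor ((c.push f).obj x)).hom =
      c.tensMap (c.pushε f).hom (𝟙 _) ≫ (c.pushμ f (c.tensUnit A) x).hom ≫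
        (c.push f).map (c.tensLeftUnitor x).hom := by
  apply fiber_ext (𝟙_ B ◁ f ≫ η[A'] ▷ A' ≫ μ[A'])
    (𝟙_ E ◁ c.lift f x ≫ c.u A' ▷ _ ≫ c.q _ _)
    (by
      have h := isStronglyCocartesian_whiskerLeft f (c.lift f x) (unitObj P)
      have h' : P.IsStronglyCocartesian (𝟙_ B ◁ f) (𝟙_ E ◁ c.lift f x) := h
      infer_instance)
  have h1 : 𝟙_ E ◁ c.lift f x ≫ c.u A' ▷ _ ≫ incl.map (c.pushε f).hom ▷ _ =
      c.u A ▷ incl.obj x ≫ (c.lift f _ ⊗ₘ c.lift f x) := by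
    simp only [← tensorHom_id, ← id_tensorHom, tensorHom_comp_tensorHom, u_pushε, Category.comp_id,
      Category.id_comp]
  simp only [Functor.map_comp, Category.assoc, q_tensMap_id_right_assoc, q_tensLeftUnitor]
  rw [reassoc_of% h1, q_pushμ_assoc, lift_push_map, q_tensLeftUnitor_assoc]
  simp

theorem pushμ_right_unitality (x : P.Fiber A) :
    (c.tensRightUnitor ((c.push f).obj x)).hom =
      c.tensMap (𝟙 _) (c.pushε f).hom ≫ (c.pushμ f x (c.tensUnit A)).hom ≫
        (c.push f).map (c.tensRightUnitor x).hom := by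
  apply fiber_ext (f ▷ 𝟙_ B ≫ A' ◁ η[A'] ≫ μ[A'])
    (c.lift f x ▷ 𝟙_ E ≫ _ ◁ c.u A' ≫ c.q _ _)
    (by
      have h := isStronglyCocartesian_whiskerRight f (c.lift f x) (unitObj P)
      have h' : P.IsStronglyCocartesian (f ▷ 𝟙_ B) (c.lift f x ▷ 𝟙_ E) := h
      infer_instance)
  have h1 : c.lift f x ▷ 𝟙_ E ≫ _ ◁ c.u A' ≫ _ ◁ incl.map (c.pushε f).hom =
      incl.obj x ◁ c.u A ≫ (c.lift f x ⊗ₘ c.lift f _) := by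
    simp only [← tensorHom_id, ← id_tensorHom, tensorHom_comp_tensorHom, u_pushε, Category.comp_id,
      Category.id_comp]
  simp only [Functor.map_comp, Category.assoc, q_tensMap_id_left_assoc, q_tensRightUnitor]
  rw [reassoc_of% h1, q_pushμ_assoc, lift_push_map, q_tensRightUnitor_assoc]
  simp

/-- For a morphism of monoids `f`, the functor `f_*` is (strong) monoidal. -/
@[reducible] noncomputable def pushMonoidal :
    letI := c.fiberMonoidal A
    letI := c.fiberMonoidal A'
    (c.push f).Monoidal :=
  letI := c.fiberMonoidal A
  letI := c.fiberMonoidal A'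
  Functor.CoreMonoidal.toMonoidal
    { εIso := c.pushε f
      μIso := c.pushμ f
      μIso_hom_natural_left := fun {x y} g z => by
        have h := c.pushμ_naturality f g (𝟙 z)
        rwa [CategoryTheory.Functor.map_id] at h
      μIso_hom_natural_right := fun {x y} z g => by
        have h := c.pushμ_naturality f (𝟙 z) g
        rwa [CategoryTheory.Functor.map_id] at h
      associativity := c.pushμ_associativity f
      left_unitality := c.pushμ_left_unitality f
      right_unitality := c.pushμ_right_unitality f }

theorem pushμ_braided [BraidedCategory B] [BraidedCategory E] [IsCommMonObj A] [IsCommMonObj A']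
    (x y : P.Fiber A) :
    (c.pushμ f x y).hom ≫ (c.push f).map (c.tensBraid x y).hom =
      (c.tensBraid ((c.push f).obj x) ((c.push f).obj y)).hom ≫ (c.pushμ f y x).hom := by
  apply fiber_ext ((f ⊗ₘ f) ≫ μ[A']) ((c.lift f x ⊗ₘ c.lift f y) ≫ c.q _ _) inferInstance
  simp

/-- For a morphism of commutative monoids `f`, the functor `f_*` is symmetric monoidal. -/
@[reducible] noncomputable def pushBraided [BraidedCategory B] [BraidedCategory E]
    [IsCommMonObj A] [IsCommMonObj A'] :
    letI := c.fiberMonoidal A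
    letI := c.fiberMonoidal A'
    letI := c.fiberSymmetric A
    letI := c.fiberSymmetric A'
    (c.push f).Braided :=
  letI := c.fiberMonoidal A
  letI := c.fiberMonoidal A'
  letI := c.fiberSymmetric A
  letI := c.fiberSymmetric A'
  { c.pushMonoidal f with
    braided := c.pushμ_braided f }

theorem pushId_unit : (c.pushε (𝟙 A)).hom ≫ (c.pushId A).hom.app (c.tensUnit A) = 𝟙 _ :=
  fiber_ext η[A] (c.u A) inferInstance (by simp)

theorem pushId_tensor (x y : P.Fiber A) :
    (c.pushμ (𝟙 A) x y).hom ≫ (c.pushId A).hom.app (c.tens x y) =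
      c.tensMap ((c.pushId A).hom.app x) ((c.pushId A).hom.app y) := by
  apply fiber_ext ((𝟙 A ⊗ₘ 𝟙 A) ≫ μ[A]) ((c.lift (𝟙 A) x ⊗ₘ c.lift (𝟙 A) y) ≫ c.q _ _)
    inferInstance
  simp only [Functor.map_comp, Category.assoc, q_pushμ_assoc, lift_pushId_hom, q_tensMap,
    tensorHom_comp_tensorHom_assoc]
  simp

variable {A'' : B} [MonObj A''] (g : A' ⟶ A'') [IsMonHom g]

theorem pushComp_unit :
    (c.pushε (f ≫ g)).hom ≫ (c.pushComp f g).hom.app (c.tensUnit A) =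
      (c.pushε g).hom ≫ (c.push g).map (c.pushε f).hom := by
  apply fiber_ext η[A''] (c.u A'') inferInstance
  simp only [Functor.map_comp, u_pushε_assoc, lift_pushComp_hom, lift_push_map]

theorem pushComp_tensor (x y : P.Fiber A) :
    (c.pushμ (f ≫ g) x y).hom ≫ (c.pushComp f g).hom.app (c.tens x y) =
      c.tensMap ((c.pushComp f g).hom.app x) ((c.pushComp f g).hom.app y) ≫
        (c.pushμ g _ _).hom ≫ (c.push g).map (c.pushμ f x y).hom := by
  apply fiber_ext (((f ≫ g) ⊗ₘ (f ≫ g)) ≫ μ[A''])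
    ((c.lift (f ≫ g) x ⊗ₘ c.lift (f ≫ g) y) ≫ c.q _ _) inferInstance
  simp only [Functor.map_comp, Category.assoc, q_pushμ_assoc, lift_pushComp_hom, q_tensMap_assoc,
    tensorHom_comp_tensorHom_assoc]
  simp only [← tensorHom_comp_tensorHom_assoc]
  have e := c.q_pushμ_assoc g ((c.push f).obj x) ((c.push f).obj y)
    (incl.map ((c.push g).map (c.pushμ f x y).hom))
  rw [lift_push_map] at e
  refine ((congrArg (fun t => (c.lift f x ⊗ₘ c.lift f y) ≫ t) e).trans ?_).symm
  exact c.q_pushμ_assoc f x y _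

end MonHom

end Monoid

end Opcleavage

end Cartesian

/-! ### The bicategories of monoidal and of symmetric monoidal categories -/

/-- Objects of the bicategory of monoidal categories. -/
structure MonoidalCat : Type (max (u + 1) (v + 1)) where
  carrier : Type u
  [category : Category.{v} carrier]
  [monoidal : MonoidalCategory carrier]

namespace MonoidalCat

attribute [instance] category monoidal

/-- Strong monoidal functors. -/
structure Hom (C D : MonoidalCat.{v, u}) where
  toFunctor : C.carrier ⥤ D.carrier
  [monoidal : toFunctor.Monoidal]

attribute [instance] Hom.monoidal

instance : CategoryStruct MonoidalCat.{v, u} where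
  Hom := Hom
  id C := ⟨𝟭 C.carrier⟩
  comp F G := ⟨F.toFunctor ⋙ G.toFunctor⟩

/-- Monoidal natural transformations. -/
@[ext] structure Hom₂ {C D : MonoidalCat.{v, u}} (F G : C ⟶ D) where
  hom : F.toFunctor ⟶ G.toFunctor
  [isMonoidal : NatTrans.IsMonoidal hom]

attribute [instance] Hom₂.isMonoidal

instance (C D : MonoidalCat.{v, u}) : Category (C ⟶ D) where
  Hom := Hom₂
  id F := ⟨𝟙 F.toFunctor⟩
  comp α β := ⟨α.hom ≫ β.hom⟩

@[ext]
theorem hom₂_ext {C D : MonoidalCat.{v, u}} {F G : C ⟶ D} {α β : F ⟶ G}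
    (h : α.hom = β.hom) : α = β :=
  Hom₂.ext h

@[simp] theorem id_toFunctor (C : MonoidalCat.{v, u}) : Hom.toFunctor (𝟙 C) = 𝟭 C.carrier := rfl

@[simp] theorem comp_toFunctor {C D E : MonoidalCat.{v, u}} (F : C ⟶ D) (G : D ⟶ E) :
    (F ≫ G).toFunctor = F.toFunctor ⋙ G.toFunctor := rfl

@[simp] theorem id_hom {C D : MonoidalCat.{v, u}} (F : C ⟶ D) :
    Hom₂.hom (𝟙 F) = 𝟙 F.toFunctor := rfl

@[simp] theorem comp_hom {C D : MonoidalCat.{v, u}} {F G H : C ⟶ D} (α : F ⟶ G) (β : G ⟶ H) :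
    (α ≫ β).hom = α.hom ≫ β.hom := rfl

theorem eqToHom_hom_app {C D : MonoidalCat.{v, u}} {F G : C ⟶ D} (h : F = G) (x : C.carrier)
    (h' : F.toFunctor.obj x = G.toFunctor.obj x) : (eqToHom h).hom.app x = eqToHom h' := by
  subst h
  rfl

/-- An invertible 2-cell from a monoidal natural isomorphism. -/
@[simps] def isoMk {C D : MonoidalCat.{v, u}} {F G : C ⟶ D} (e : F.toFunctor ≅ G.toFunctor)
    (h : NatTrans.IsMonoidal e.hom) : F ≅ G where
  hom := ⟨e.hom⟩
  inv := ⟨e.inv⟩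

/-- Whiskering of a monoidal natural transformation by a monoidal functor on the left. -/
@[simps] def whiskerLeft {C D E : MonoidalCat.{v, u}} (F : C ⟶ D) {G H : D ⟶ E} (β : G ⟶ H) :
    F ≫ G ⟶ F ≫ H where
  hom := Functor.whiskerLeft F.toFunctor β.hom
  isMonoidal := NatTrans.IsMonoidal.whiskerLeft (F₁ := F.toFunctor) β.hom

/-- Whiskering of a monoidal natural transformation by a monoidal functor on the right. -/
@[simps] def whiskerRight {C D E : MonoidalCat.{v, u}} {F G : C ⟶ D} (α : F ⟶ G) (H : D ⟶ E) :
    F ≫ H ⟶ G ≫ H where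
  hom := Functor.whiskerRight α.hom H.toFunctor
  isMonoidal := NatTrans.IsMonoidal.whiskerRight α.hom (G₁ := H.toFunctor)

instance : Bicategory MonoidalCat.{v, u} where
  whiskerLeft := whiskerLeft
  whiskerRight := whiskerRight
  associator F G H := isoMk (F := (F ≫ G) ≫ H) (G := F ≫ G ≫ H)
    (Functor.associator F.toFunctor G.toFunctor H.toFunctor)
    (NatTrans.IsMonoidal.instHomFunctorAssociator F.toFunctor G.toFunctor H.toFunctor)
  leftUnitor F := isoMk (F := 𝟙 _ ≫ F) (G := F) F.toFunctor.leftUnitor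
    (NatTrans.IsMonoidal.instHomFunctorLeftUnitor F.toFunctor)
  rightUnitor F := isoMk (F := F ≫ 𝟙 _) (G := F) F.toFunctor.rightUnitor
    (NatTrans.IsMonoidal.instHomFunctorRightUnitor F.toFunctor)
  whiskerLeft_id _ _ := by apply hom₂_ext; ext; simp
  whiskerLeft_comp _ _ _ _ _ _ := by apply hom₂_ext; ext; simp
  id_whiskerLeft _ := by apply hom₂_ext; ext; simp
  comp_whiskerLeft _ _ _ _ _ := by apply hom₂_ext; ext; simp
  id_whiskerRight _ _ := by apply hom₂_ext; ext; simp
  comp_whiskerRight _ _ _ := by apply hom₂_ext; ext; simp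
  whiskerRight_id _ := by apply hom₂_ext; ext; simp
  whiskerRight_comp _ _ _ := by apply hom₂_ext; ext; simp
  whisker_assoc _ _ _ _ _ := by apply hom₂_ext; ext; simp
  whisker_exchange _ _ := by apply hom₂_ext; ext; simp
  pentagon _ _ _ _ := by apply hom₂_ext; ext; simp
  triangle _ _ := by apply hom₂_ext; ext; simp

/-- The 2-functor forgetting monoidal structures. -/
def forget : Pseudofunctor MonoidalCat.{v, u} Cat.{v, u} where
  obj C := Cat.of C.carrier
  map F := F.toFunctor.toCatHom
  map₂ α := NatTrans.toCatHom₂ α.hom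
  mapId C := Iso.refl (𝟭 C.carrier).toCatHom
  mapComp F G := Iso.refl (F.toFunctor ⋙ G.toFunctor).toCatHom
  map₂_whisker_left F G H β := by
    apply Cat.Hom₂.ext
    change Functor.whiskerLeft F.toFunctor β.hom = 𝟙 (F.toFunctor ⋙ G.toFunctor) ≫
      Functor.whiskerLeft F.toFunctor β.hom ≫ 𝟙 (F.toFunctor ⋙ H.toFunctor)
    simp
  map₂_whisker_right {_ _ _ F G} α H := by
    apply Cat.Hom₂.ext
    change Functor.whiskerRight α.hom H.toFunctor = 𝟙 (F.toFunctor ⋙ H.toFunctor) ≫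
      Functor.whiskerRight α.hom H.toFunctor ≫ 𝟙 (G.toFunctor ⋙ H.toFunctor)
    simp
  map₂_associator F G H := by
    apply Cat.Hom₂.ext
    change (Functor.associator F.toFunctor G.toFunctor H.toFunctor).hom =
      𝟙 ((F.toFunctor ⋙ G.toFunctor) ⋙ H.toFunctor) ≫
        Functor.whiskerRight (𝟙 (F.toFunctor ⋙ G.toFunctor)) H.toFunctor ≫
          (Functor.associator F.toFunctor G.toFunctor H.toFunctor).hom ≫
            Functor.whiskerLeft F.toFunctor (𝟙 (G.toFunctor ⋙ H.toFunctor)) ≫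
              𝟙 (F.toFunctor ⋙ G.toFunctor ⋙ H.toFunctor)
    ext; simp
  map₂_left_unitor F := by
    apply Cat.Hom₂.ext
    change F.toFunctor.leftUnitor.hom = 𝟙 (𝟭 _ ⋙ F.toFunctor) ≫
        Functor.whiskerRight (𝟙 (𝟭 _)) F.toFunctor ≫ F.toFunctor.leftUnitor.hom
    ext; simp
  map₂_right_unitor F := by
    apply Cat.Hom₂.ext
    change F.toFunctor.rightUnitor.hom = 𝟙 (F.toFunctor ⋙ 𝟭 _) ≫
        Functor.whiskerLeft F.toFunctor (𝟙 (𝟭 _)) ≫ F.toFunctor.rightUnitor.hom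
    ext; simp

end MonoidalCat

/-- Objects of the bicategory of symmetric monoidal categories. -/
structure SymMonoidalCat : Type (max (u + 1) (v + 1)) where
  carrier : Type u
  [category : Category.{v} carrier]
  [monoidal : MonoidalCategory carrier]
  [symmetric : SymmetricCategory carrier]

namespace SymMonoidalCat

attribute [instance] category monoidal symmetric

/-- Symmetric (strong) monoidal functors. -/
structure Hom (C D : SymMonoidalCat.{v, u}) where
  toFunctor : C.carrier ⥤ D.carrier
  [braided : toFunctor.Braided]

attribute [instance] Hom.braided

instance : CategoryStruct SymMonoidalCat.{v, u} where
  Hom := Hom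
  id C := ⟨𝟭 C.carrier⟩
  comp F G := ⟨F.toFunctor ⋙ G.toFunctor⟩

/-- Monoidal natural transformations. -/
@[ext] structure Hom₂ {C D : SymMonoidalCat.{v, u}} (F G : C ⟶ D) where
  hom : F.toFunctor ⟶ G.toFunctor
  [isMonoidal : NatTrans.IsMonoidal hom]

attribute [instance] Hom₂.isMonoidal

instance (C D : SymMonoidalCat.{v, u}) : Category (C ⟶ D) where
  Hom := Hom₂
  id F := ⟨𝟙 F.toFunctor⟩
  comp α β := ⟨α.hom ≫ β.hom⟩

@[ext]
theorem hom₂_ext {C D : SymMonoidalCat.{v, u}} {F G : C ⟶ D} {α β : F ⟶ G}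
    (h : α.hom = β.hom) : α = β :=
  Hom₂.ext h

@[simp] theorem id_toFunctor (C : SymMonoidalCat.{v, u}) : Hom.toFunctor (𝟙 C) = 𝟭 C.carrier := rfl

@[simp] theorem comp_toFunctor {C D E : SymMonoidalCat.{v, u}} (F : C ⟶ D) (G : D ⟶ E) :
    (F ≫ G).toFunctor = F.toFunctor ⋙ G.toFunctor := rfl

@[simp] theorem id_hom {C D : SymMonoidalCat.{v, u}} (F : C ⟶ D) :
    Hom₂.hom (𝟙 F) = 𝟙 F.toFunctor := rfl

@[simp] theorem comp_hom {C D : SymMonoidalCat.{v, u}} {F G H : C ⟶ D} (α : F ⟶ G) (β : G ⟶ H) :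
    (α ≫ β).hom = α.hom ≫ β.hom := rfl

theorem eqToHom_hom_app {C D : SymMonoidalCat.{v, u}} {F G : C ⟶ D} (h : F = G) (x : C.carrier)
    (h' : F.toFunctor.obj x = G.toFunctor.obj x) : (eqToHom h).hom.app x = eqToHom h' := by
  subst h
  rfl

/-- An invertible 2-cell from a monoidal natural isomorphism. -/
@[simps] def isoMk {C D : SymMonoidalCat.{v, u}} {F G : C ⟶ D} (e : F.toFunctor ≅ G.toFunctor)
    (h : NatTrans.IsMonoidal e.hom) : F ≅ G where
  hom := ⟨e.hom⟩
  inv := ⟨e.inv⟩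

/-- Whiskering of a monoidal natural transformation by a monoidal functor on the left. -/
@[simps] def whiskerLeft {C D E : SymMonoidalCat.{v, u}} (F : C ⟶ D) {G H : D ⟶ E} (β : G ⟶ H) :
    F ≫ G ⟶ F ≫ H where
  hom := Functor.whiskerLeft F.toFunctor β.hom
  isMonoidal := NatTrans.IsMonoidal.whiskerLeft (F₁ := F.toFunctor) β.hom

/-- Whiskering of a monoidal natural transformation by a monoidal functor on the right. -/
@[simps] def whiskerRight {C D E : SymMonoidalCat.{v, u}} {F G : C ⟶ D} (α : F ⟶ G) (H : D ⟶ E) :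
    F ≫ H ⟶ G ≫ H where
  hom := Functor.whiskerRight α.hom H.toFunctor
  isMonoidal := NatTrans.IsMonoidal.whiskerRight α.hom (G₁ := H.toFunctor)

instance : Bicategory SymMonoidalCat.{v, u} where
  whiskerLeft := whiskerLeft
  whiskerRight := whiskerRight
  associator F G H := isoMk (F := (F ≫ G) ≫ H) (G := F ≫ G ≫ H)
    (Functor.associator F.toFunctor G.toFunctor H.toFunctor)
    (NatTrans.IsMonoidal.instHomFunctorAssociator F.toFunctor G.toFunctor H.toFunctor)
  leftUnitor F := isoMk (F := 𝟙 _ ≫ F) (G := F) F.toFunctor.leftUnitor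
    (NatTrans.IsMonoidal.instHomFunctorLeftUnitor F.toFunctor)
  rightUnitor F := isoMk (F := F ≫ 𝟙 _) (G := F) F.toFunctor.rightUnitor
    (NatTrans.IsMonoidal.instHomFunctorRightUnitor F.toFunctor)
  whiskerLeft_id _ _ := by apply hom₂_ext; ext; simp
  whiskerLeft_comp _ _ _ _ _ _ := by apply hom₂_ext; ext; simp
  id_whiskerLeft _ := by apply hom₂_ext; ext; simp
  comp_whiskerLeft _ _ _ _ _ := by apply hom₂_ext; ext; simp
  id_whiskerRight _ _ := by apply hom₂_ext; ext; simp
  comp_whiskerRight _ _ _ := by apply hom₂_ext; ext; simp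
  whiskerRight_id _ := by apply hom₂_ext; ext; simp
  whiskerRight_comp _ _ _ := by apply hom₂_ext; ext; simp
  whisker_assoc _ _ _ _ _ := by apply hom₂_ext; ext; simp
  whisker_exchange _ _ := by apply hom₂_ext; ext; simp
  pentagon _ _ _ _ := by apply hom₂_ext; ext; simp
  triangle _ _ := by apply hom₂_ext; ext; simp

/-- The 2-functor forgetting the symmetries. -/
def toMonoidalCat : Pseudofunctor SymMonoidalCat.{v, u} MonoidalCat.{v, u} where
  obj C := ⟨C.carrier⟩
  map F := ⟨F.toFunctor⟩
  map₂ α := ⟨α.hom⟩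
  mapId C := Iso.refl _
  mapComp F G := Iso.refl _
  map₂_associator F G H := by
    apply MonoidalCat.hom₂_ext
    change (Functor.associator F.toFunctor G.toFunctor H.toFunctor).hom =
      𝟙 ((F.toFunctor ⋙ G.toFunctor) ⋙ H.toFunctor) ≫
        Functor.whiskerRight (𝟙 (F.toFunctor ⋙ G.toFunctor)) H.toFunctor ≫
          (Functor.associator F.toFunctor G.toFunctor H.toFunctor).hom ≫
            Functor.whiskerLeft F.toFunctor (𝟙 (G.toFunctor ⋙ H.toFunctor)) ≫
              𝟙 (F.toFunctor ⋙ G.toFunctor ⋙ H.toFunctor)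
    ext; simp

/-- The 2-functor forgetting symmetric monoidal structures. -/
def forget : Pseudofunctor SymMonoidalCat.{v, u} Cat.{v, u} :=
  toMonoidalCat.comp MonoidalCat.forget

end SymMonoidalCat

/-! ### The induced pseudofunctors on internal (commutative) monoids -/

section Induced

variable {B : Type u₁} [Category.{v₁} B] [CartesianMonoidalCategory B]
  {E : Type u₂} [Category.{v₂} E] [CartesianMonoidalCategory E]
  {P : E ⥤ B} [hP : IsCartesianMonoidalOpfibration P]

namespace Opcleavage

variable (c : Opcleavage P)

/-- The fibre over an internal monoid, as a monoidal category. -/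
noncomputable def monFiber (A : Mon B) : MonoidalCat.{v₂, u₂} :=
  letI := c.fiberMonoidal A.X
  ⟨P.Fiber A.X⟩

/-- The change of base along a morphism of internal monoids, as a strong monoidal functor. -/
noncomputable def monPush {A A' : Mon B} (f : A ⟶ A') : c.monFiber A ⟶ c.monFiber A' :=
  letI := c.fiberMonoidal A.X
  letI := c.fiberMonoidal A'.X
  letI := c.pushMonoidal f.hom
  (⟨c.push f.hom⟩ : MonoidalCat.Hom ⟨P.Fiber A.X⟩ ⟨P.Fiber A'.X⟩)

/-- The canonical isomorphism `(1_A)_* ≅ 1` of monoidal functors. -/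
noncomputable def monPushId (A : Mon B) : c.monPush (𝟙 A) ≅ 𝟙 (c.monFiber A) :=
  MonoidalCat.isoMk (F := c.monPush (𝟙 A)) (G := 𝟙 (c.monFiber A)) (c.pushId A.X)
    { unit := c.pushId_unit
      tensor := fun x y => (c.pushId_tensor x y).trans (Category.comp_id _).symm }

/-- The canonical isomorphism `(f ≫ g)_* ≅ f_* ⋙ g_*` of monoidal functors. -/
noncomputable def monPushComp {A A' A'' : Mon B} (f : A ⟶ A') (g : A' ⟶ A'') :
    c.monPush (f ≫ g) ≅ c.monPush f ≫ c.monPush g :=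
  MonoidalCat.isoMk (F := c.monPush (f ≫ g)) (G := c.monPush f ≫ c.monPush g)
    (c.pushComp f.hom g.hom)
    { unit := c.pushComp_unit f.hom g.hom
      tensor := c.pushComp_tensor f.hom g.hom }

/-- The pseudofunctor from internal monoids in the base to monoidal categories, with values
the fibres endowed with the induced monoidal structure. -/
noncomputable def monPseudofunctor :
    Pseudofunctor (LocallyDiscrete (Mon B)) MonoidalCat.{v₂, u₂} :=
  LocallyDiscrete.mkPseudofunctor c.monFiber c.monPush c.monPushId c.monPushComp
    (fun f g h => by
      apply MonoidalCat.hom₂_ext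
      ext x
      refine Eq.trans ?_ (MonoidalCat.eqToHom_hom_app (F := c.monPush ((f ≫ g) ≫ h))
        (G := c.monPush (f ≫ g ≫ h)) (congrArg c.monPush (Category.assoc f g h)) x
        (congrArg (fun k => (c.monPush k).toFunctor.obj x) (Category.assoc f g h))).symm
      refine Eq.trans ?_ (c.pushComp_assoc f.hom g.hom h.hom x)
      exact congrArg (fun t => (c.pushComp (f.hom ≫ g.hom) h.hom).hom.app x ≫
        (c.push h.hom).map ((c.pushComp f.hom g.hom).hom.app x) ≫ t) (Category.id_comp
          ((c.pushComp g.hom h.hom).inv.app ((c.push f.hom).obj x) ≫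
            (c.pushComp f.hom (g.hom ≫ h.hom)).inv.app x)))
    (fun f => by
      apply MonoidalCat.hom₂_ext
      ext x
      refine Eq.trans ?_ (MonoidalCat.eqToHom_hom_app (F := c.monPush (𝟙 _ ≫ f))
        (G := c.monPush f) (congrArg c.monPush (Category.id_comp f)) x
        (congrArg (fun k => (c.monPush k).toFunctor.obj x) (Category.id_comp f))).symm
      refine Eq.trans ?_ (c.pushComp_id_left f.hom x)
      exact congrArg (fun t => (c.pushComp (𝟙 _) f.hom).hom.app x ≫ t)
        (Category.comp_id ((c.push f.hom).map ((c.pushId _).hom.app x))))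
    (fun f => by
      apply MonoidalCat.hom₂_ext
      ext x
      refine Eq.trans ?_ (MonoidalCat.eqToHom_hom_app (F := c.monPush (f ≫ 𝟙 _))
        (G := c.monPush f) (congrArg c.monPush (Category.comp_id f)) x
        (congrArg (fun k => (c.monPush k).toFunctor.obj x) (Category.comp_id f))).symm
      refine Eq.trans ?_ (c.pushComp_id_right f.hom x)
      exact congrArg (fun t => (c.pushComp f.hom (𝟙 _)).hom.app x ≫ t)
        (Category.comp_id ((c.pushId _).hom.app ((c.push f.hom).obj x))))

section Commutative

variable [BraidedCategory B] [BraidedCategory E]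

/-- The underlying arrow of a morphism of internal commutative monoids. -/
abbrev commHom {A A' : CommMon B} (f : A ⟶ A') : A.X ⟶ A'.X := f.hom.hom

instance isMonHom_commHom {A A' : CommMon B} (f : A ⟶ A') : IsMonHom (commHom f) :=
  f.hom.isMonHom_hom

/-- The fibre over an internal commutative monoid, as a symmetric monoidal category. -/
noncomputable def commMonFiber (A : CommMon B) : SymMonoidalCat.{v₂, u₂} :=
  letI := c.fiberMonoidal A.X
  letI := c.fiberSymmetric A.X
  ⟨P.Fiber A.X⟩

/-- The change of base along a morphism of internal commutative monoids, as a symmetric monoidal functor. -/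
noncomputable def commMonPush {A A' : CommMon B} (f : A ⟶ A') : c.commMonFiber A ⟶ c.commMonFiber A' :=
  letI := c.fiberMonoidal A.X
  letI := c.fiberMonoidal A'.X
  letI := c.fiberSymmetric A.X
  letI := c.fiberSymmetric A'.X
  letI := c.pushBraided (commHom f)
  (⟨c.push (commHom f)⟩ : SymMonoidalCat.Hom ⟨P.Fiber A.X⟩ ⟨P.Fiber A'.X⟩)

/-- The canonical isomorphism `(1_A)_* ≅ 1` of symmetric monoidal functors. -/
noncomputable def commMonPushId (A : CommMon B) : c.commMonPush (𝟙 A) ≅ 𝟙 (c.commMonFiber A) :=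
  SymMonoidalCat.isoMk (F := c.commMonPush (𝟙 A)) (G := 𝟙 (c.commMonFiber A)) (c.pushId A.X)
    { unit := c.pushId_unit
      tensor := fun x y => (c.pushId_tensor x y).trans (Category.comp_id _).symm }

/-- The canonical isomorphism `(f ≫ g)_* ≅ f_* ⋙ g_*` of symmetric monoidal functors. -/
noncomputable def commMonPushComp {A A' A'' : CommMon B} (f : A ⟶ A') (g : A' ⟶ A'') :
    c.commMonPush (f ≫ g) ≅ c.commMonPush f ≫ c.commMonPush g :=
  SymMonoidalCat.isoMk (F := c.commMonPush (f ≫ g)) (G := c.commMonPush f ≫ c.commMonPush g)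
    (c.pushComp (commHom f) (commHom g))
    { unit := c.pushComp_unit (commHom f) (commHom g)
      tensor := c.pushComp_tensor (commHom f) (commHom g) }

/-- The pseudofunctor from internal commutative monoids in the base to symmetric monoidal categories, with values
the fibres endowed with the induced symmetric monoidal structure. -/
noncomputable def commMonPseudofunctor :
    Pseudofunctor (LocallyDiscrete (CommMon B)) SymMonoidalCat.{v₂, u₂} :=
  LocallyDiscrete.mkPseudofunctor c.commMonFiber c.commMonPush c.commMonPushId c.commMonPushComp
    (fun f g h => by
      apply SymMonoidalCat.hom₂_ext
      ext x
      refine Eq.trans ?_ (SymMonoidalCat.eqToHom_hom_app (F := c.commMonPush ((f ≫ g) ≫ h))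
        (G := c.commMonPush (f ≫ g ≫ h)) (congrArg c.commMonPush (Category.assoc f g h)) x
        (congrArg (fun k => (c.commMonPush k).toFunctor.obj x) (Category.assoc f g h))).symm
      refine Eq.trans ?_ (c.pushComp_assoc (commHom f) (commHom g) (commHom h) x)
      exact congrArg (fun t => (c.pushComp ((commHom f) ≫ (commHom g)) (commHom h)).hom.app x ≫
        (c.push (commHom h)).map ((c.pushComp (commHom f) (commHom g)).hom.app x) ≫ t) (Category.id_comp
          ((c.pushComp (commHom g) (commHom h)).inv.app ((c.push (commHom f)).obj x) ≫
            (c.pushComp (commHom f) ((commHom g) ≫ (commHom h))).inv.app x)))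
    (fun f => by
      apply SymMonoidalCat.hom₂_ext
      ext x
      refine Eq.trans ?_ (SymMonoidalCat.eqToHom_hom_app (F := c.commMonPush (𝟙 _ ≫ f))
        (G := c.commMonPush f) (congrArg c.commMonPush (Category.id_comp f)) x
        (congrArg (fun k => (c.commMonPush k).toFunctor.obj x) (Category.id_comp f))).symm
      refine Eq.trans ?_ (c.pushComp_id_left (commHom f) x)
      exact congrArg (fun t => (c.pushComp (𝟙 _) (commHom f)).hom.app x ≫ t)
        (Category.comp_id ((c.push (commHom f)).map ((c.pushId _).hom.app x))))
    (fun f => by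
      apply SymMonoidalCat.hom₂_ext
      ext x
      refine Eq.trans ?_ (SymMonoidalCat.eqToHom_hom_app (F := c.commMonPush (f ≫ 𝟙 _))
        (G := c.commMonPush f) (congrArg c.commMonPush (Category.comp_id f)) x
        (congrArg (fun k => (c.commMonPush k).toFunctor.obj x) (Category.comp_id f))).symm
      refine Eq.trans ?_ (c.pushComp_id_right (commHom f) x)
      exact congrArg (fun t => (c.pushComp (commHom f) (𝟙 _)).hom.app x ≫ t)
        (Category.comp_id ((c.pushId _).hom.app ((c.push (commHom f)).obj x))))

end Commutative

end Opcleavage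

end Induced

/-! ### 2-groups and symmetric 2-groups -/

section TwoGroups

/-- A 2-group (categorical group): a monoidal groupoid in which every object is weakly invertible
with respect to the tensor product. -/
structure IsTwoGroup (C : Type u) [Category.{v} C] [MonoidalCategory C] : Prop where
  isGroupoid : IsGroupoid C
  exists_inverse : ∀ x : C, ∃ y : C, Nonempty (x ⊗ y ≅ 𝟙_ C) ∧ Nonempty (y ⊗ x ≅ 𝟙_ C)

/-- The 2-category of 2-groups, (strong) monoidal functors and monoidal natural transformations,
as a full sub-bicategory of the one of monoidal categories. -/
abbrev TwoGrp : Type (max (u + 1) (v + 1)) :=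
  Bicategory.InducedBicategory MonoidalCat.{v, u}
    (fun X : { X : MonoidalCat.{v, u} // IsTwoGroup X.carrier } => X.1)

/-- The 2-category of symmetric 2-groups, symmetric monoidal functors and monoidal natural
transformations, as a full sub-bicategory of the one of symmetric monoidal categories. -/
abbrev SymTwoGrp : Type (max (u + 1) (v + 1)) :=
  Bicategory.InducedBicategory SymMonoidalCat.{v, u}
    (fun X : { X : SymMonoidalCat.{v, u} // IsTwoGroup X.carrier } => X.1)

/-- The inclusion of 2-groups in monoidal categories. -/
def TwoGrp.toMonoidalCat : Pseudofunctor TwoGrp.{v, u} MonoidalCat.{v, u} :=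
  Bicategory.InducedBicategory.forget.toPseudofunctor

/-- The 2-functor taking the underlying category of a 2-group. -/
def TwoGrp.forget : Pseudofunctor TwoGrp.{v, u} Cat.{v, u} :=
  TwoGrp.toMonoidalCat.comp MonoidalCat.forget

/-- The inclusion of symmetric 2-groups in symmetric monoidal categories. -/
def SymTwoGrp.toSymMonoidalCat : Pseudofunctor SymTwoGrp.{v, u} SymMonoidalCat.{v, u} :=
  Bicategory.InducedBicategory.forget.toPseudofunctor

/-- The 2-functor taking the underlying category of a symmetric 2-group. -/
def SymTwoGrp.forget : Pseudofunctor SymTwoGrp.{v, u} Cat.{v, u} :=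
  SymTwoGrp.toSymMonoidalCat.comp SymMonoidalCat.forget

end TwoGroups

end GroupalOpfib

namespace GroupalOpfib

open MonoidalCategory CartesianMonoidalCategory MonObj Bicategory

/-! ### Pseudofunctors out of locally discrete bicategories and into full sub-bicategories -/

section Pseudofunctors

/-! The monoidal structures, the strong monoidal functors `f_*` and their coherence 2-cells are
already packaged in `monPseudofunctor` and `commMonPseudofunctor`. Since 2-groups form a full
sub-bicategory of monoidal categories, lifting to internal groups only asks that each fibre over an
internal group `A` be a 2-group: being a groupoid is the hypothesis, and what has to be found is a
weak inverse of each object.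

When the fibres are groupoids, every arrow of the total category is cocartesian: it factors as a
chosen lifting followed by a vertical arrow, and the latter is invertible
(`isStronglyCocartesian_of_isGroupoid`). Hence two arrows with the same source over the same arrow
of the base have isomorphic codomains. For `x` over `A`, the pairing `x ⟶ x × ι_* x` of the identity
with the lifting of `ι`, followed by `x × ι_* x ⟶ x ⊗ ι_* x`, lies over `(1, ι) ≫ μ`, which the
group axiom identifies with the constant arrow `A ⟶ 1 ⟶ A`. The arrow `x ⟶ 1 ⟶ η_* 1` lies over that
constant arrow too, so `x ⊗ ι_* x` is isomorphic to the unit (`isoTensUnit`, `isTwoGroup_fiber`).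
The other side is the same with the factors exchanged. The groupoid hypothesis is essential here: a
pairing such as a diagonal is not cocartesian in a general opfibration. Commutativity plays no role
in this argument, so abelian groups need nothing more than the symmetric structure already built.

The rest is bookkeeping. The required identities are equalities of pseudofunctors, not mere
equivalences. They are within reach because the sources are locally discrete: 2-cells there are
identities, so only objects, 1-cells and coherence isomorphisms have to be compared
(`pseudofunctor_ext_of_isLocallyDiscrete`). Objects and 1-cells agree definitionally, and the
coherence isomorphisms agree up to composition with identities. -/

/-- Prelax functors out of a locally discrete bicategory are determined by their effect on
objects and 1-cells. -/
theorem prelaxFunctor_ext_of_isLocallyDiscrete {C D : Type*} [Bicategory C] [IsLocallyDiscrete C]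
    [Bicategory D] {F G : PrelaxFunctor C D} (h : F.toPrefunctor = G.toPrefunctor) : F = G := by
  obtain ⟨⟨F, F₂⟩, hF, hF'⟩ := F
  obtain ⟨⟨G, G₂⟩, hG, hG'⟩ := G
  obtain rfl : F = G := h
  have h₂ : @F₂ = @G₂ := by
    funext a b f g α
    -- A 2-cell in a discrete hom-category forces its ends to coincide and is then an identity,
    -- which both functors must preserve.
    obtain rfl := obj_ext_of_isDiscrete α
    obtain rfl : α = 𝟙 f := Subsingleton.elim _ _
    exact (hF f).trans (hG f).symm
  subst h₂
  rfl

/-- Pseudofunctors out of a locally discrete bicategory are determined by their effect on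
objects and 1-cells and by their coherence isomorphisms. -/
theorem pseudofunctor_ext_of_isLocallyDiscrete {C D : Type*} [Bicategory C] [IsLocallyDiscrete C]
    [Bicategory D] {F G : Pseudofunctor C D}
    (h : F.toPrefunctor = G.toPrefunctor)
    (mapId : ∀ a, HEq (F.mapId a) (G.mapId a))
    (mapComp : ∀ {a b c : C} (f : a ⟶ b) (g : b ⟶ c), HEq (F.mapComp f g) (G.mapComp f g)) :
    F = G := by
  have h' := prelaxFunctor_ext_of_isLocallyDiscrete h
  obtain ⟨F, F₀, F₁⟩ := F
  obtain ⟨G, G₀, G₁⟩ := G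
  obtain rfl : F = G := h'
  -- With the prelax functors identified, the two families of coherence isomorphisms have the same
  -- types, so the heterogeneous equalities become equalities; all remaining fields are
  -- propositions.
  obtain rfl : F₀ = G₀ := funext fun a => eq_of_heq (mapId a)
  obtain rfl : @F₁ = @G₁ := by
    funext a b c f g
    exact eq_of_heq (mapComp f g)
  rfl

/-- Composition of pseudofunctors out of a locally discrete bicategory is associative. -/
theorem pseudofunctor_comp_assoc {C₁ C₂ C₃ C₄ : Type*} [Bicategory C₁] [IsLocallyDiscrete C₁]
    [Bicategory C₂] [Bicategory C₃] [Bicategory C₄] (F : Pseudofunctor C₁ C₂)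
    (G : Pseudofunctor C₂ C₃) (H : Pseudofunctor C₃ C₄) :
    (F.comp G).comp H = F.comp (G.comp H) :=
  pseudofunctor_ext_of_isLocallyDiscrete rfl
    -- One bracketing applies `H` to a composite 2-cell, the other composes the images under `H`;
    -- functoriality of `H` on 2-cells and associativity reconcile them.
    (fun _ => heq_of_eq (Iso.ext
      ((congrArg (· ≫ _) (H.map₂_comp _ _)).trans (Category.assoc _ _ _))))
    (fun _ _ => heq_of_eq (Iso.ext
      ((congrArg (· ≫ _) (H.map₂_comp _ _)).trans (Category.assoc _ _ _))))

/-- A pseudofunctor all of whose values satisfy a property lifts to the full sub-bicategory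
defined by that property. -/
def liftInduced {C D : Type*} [Bicategory C] [Bicategory D] (p : D → Prop) (F : Pseudofunctor C D)
    (h : ∀ X, p (F.obj X)) :
    Pseudofunctor C (InducedBicategory D (fun X : { X : D // p X } => X.1)) where
  obj X := (⟨F.obj X, h X⟩ : { X : D // p X })
  map f := InducedBicategory.mkHom (F.map f)
  map₂ α := InducedBicategory.mkHom₂ (F.map₂ α)
  mapId X := InducedBicategory.isoMk (F.mapId X)
  mapComp f g := InducedBicategory.isoMk (F.mapComp f g)
  -- Fullness makes the 1-cells, 2-cells and structural isomorphisms those of `D`, so each axiom is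
  -- the corresponding axiom of `F`.
  map₂_whisker_left f _ _ α := InducedBicategory.hom₂_ext (F.map₂_whisker_left f α)
  map₂_whisker_right α f := InducedBicategory.hom₂_ext (F.map₂_whisker_right α f)
  map₂_associator f g k := InducedBicategory.hom₂_ext (F.map₂_associator f g k)
  map₂_left_unitor f := InducedBicategory.hom₂_ext (F.map₂_left_unitor f)
  map₂_right_unitor f := InducedBicategory.hom₂_ext (F.map₂_right_unitor f)
  map₂_id f := InducedBicategory.hom₂_ext (F.map₂_id f)
  map₂_comp α β := InducedBicategory.hom₂_ext (F.map₂_comp α β)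

/-- The inclusion of a full sub-bicategory is strict, so composing with it changes the coherence
isomorphisms of `F` only by an identity factor on the right. -/
theorem liftInduced_comp_forget {C D : Type*} [Bicategory C] [IsLocallyDiscrete C] [Bicategory D]
    (p : D → Prop) (F : Pseudofunctor C D) (h : ∀ X, p (F.obj X)) :
    (liftInduced p F h).comp InducedBicategory.forget.toPseudofunctor = F :=
  pseudofunctor_ext_of_isLocallyDiscrete rfl
    (fun _ => heq_of_eq (Iso.ext (Category.comp_id _)))
    (fun _ _ => heq_of_eq (Iso.ext (Category.comp_id _)))

end Pseudofunctors

/-! ### Weak inverses in the fibre over an internal group -/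

section Inverse

variable {B : Type u₁} [Category.{v₁} B] {E : Type u₂} [Category.{v₂} E] {P : E ⥤ B}

/-- If the fibres of an opfibration are groupoids, then every arrow is cocartesian. -/
theorem isStronglyCocartesian_of_isGroupoid (c : Opcleavage P)
    (hfib : ∀ A : B, IsGroupoid (P.Fiber A)) {S T : B} (f : S ⟶ T) {a : P.Fiber S} {b : P.Fiber T}
    (φ : incl.obj a ⟶ incl.obj b) (hφ : P.IsHomLift f φ) : P.IsStronglyCocartesian f φ := by
  -- The vertical part of `φ`, left over after factoring through the chosen lifting of `f`, is
  -- invertible because it lives in the fibre over `T`.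
  have := (hfib T).all_isIso (descend f (c.lift f a) inferInstance φ hφ)
  have hlift : P.IsHomLift (𝟙 T) (incl.map (descend f (c.lift f a) inferInstance φ hφ)) :=
    (descend f (c.lift f a) inferInstance φ hφ).2
  -- Cocartesian arrows compose, and an isomorphism over an identity is cocartesian; the composite
  -- is `φ` itself.
  have h : P.IsStronglyCocartesian (f ≫ 𝟙 T)
      (c.lift f a ≫ incl.map (descend f (c.lift f a) inferInstance φ hφ)) := inferInstance
  rw [fac_descend] at h
  exact isStronglyCocartesian_of_eq (Category.comp_id f) h

variable [CartesianMonoidalCategory B] [CartesianMonoidalCategory E]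
  [hP : IsCartesianMonoidalOpfibration P]

/-- The only real content is that `P` sends the terminal object to the terminal object; the arrows
below then agree by terminality. This places `x ⟶ 1 ⟶ η_* 1` over the constant arrow in
`isoTensUnit`. -/
instance isHomLift_toUnit {S : B} (x : P.Fiber S) :
    P.IsHomLift (toUnit S) (toUnit (incl.obj x)) := by
  obtain ⟨x, rfl⟩ := x
  exact IsHomLift.of_fac P _ _ rfl hP.obj_unit (toUnit_unique _ _)

namespace Opcleavage

variable (c : Opcleavage P) {A : B}

/-- If the fibres are groupoids, then an object over an internal monoid `A` is isomorphic to the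
unit object as soon as it receives an arrow over the constant arrow `A ⟶ 1 ⟶ A`. -/
noncomputable def isoTensUnit [MonObj A] (hfib : ∀ A : B, IsGroupoid (P.Fiber A)) {x y : P.Fiber A}
    (φ : incl.obj x ⟶ incl.obj y) (hφ : P.IsHomLift (toUnit A ≫ η[A]) φ) :
    y ≅ c.tensUnit A :=
  -- Both `φ` and the arrow through the terminal object start at `x` and lie over the constant
  -- arrow; both are cocartesian, so the universal property compares their codomains.
  compareIso (toUnit A ≫ η[A]) φ
    (isStronglyCocartesian_of_isGroupoid c hfib _ φ hφ)
    (toUnit (incl.obj x) ≫ c.u A)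
    (isStronglyCocartesian_of_isGroupoid c hfib _ (a := x) (b := c.tensUnit A) _ inferInstance)

/-- If the fibres are groupoids, then the fibre over an internal group is a 2-group: a weak inverse
of `x` is `ι_* x`. -/
theorem isTwoGroup_fiber [GrpObj A] (hfib : ∀ A : B, IsGroupoid (P.Fiber A)) :
    letI := c.fiberMonoidal A
    IsTwoGroup (P.Fiber A) :=
  letI := c.fiberMonoidal A
  { isGroupoid := hfib A
    exists_inverse := fun x => by
      refine ⟨(c.push ι[A]).obj x, ⟨?_⟩, ⟨?_⟩⟩
      -- The pairing of the identity of `x` with the lifting of `ι` lies over `(1, ι) : A ⟶ A × A`.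
      -- Following it by `q` gives an arrow `x ⟶ x ⊗ ι_* x` over `(1, ι) ≫ μ`, which the right
      -- inverse law makes constant.
      · have h := isHomLift_lift (P := P) (𝟙 A) ι[A] (𝟙 (incl.obj x)) (c.lift ι[A] x)
        exact c.isoTensUnit hfib
          (CartesianMonoidalCategory.lift (𝟙 _) (c.lift ι[A] x) ≫ c.q x _)
          (isHomLift_of_eq (GrpObj.right_inv A) inferInstance)
      -- The factors are exchanged, and the left inverse law is used instead; no symmetry is needed.
      · have h := isHomLift_lift (P := P) ι[A] (𝟙 A) (c.lift ι[A] x) (𝟙 (incl.obj x))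
        exact c.isoTensUnit hfib
          (CartesianMonoidalCategory.lift (c.lift ι[A] x) (𝟙 _) ≫ c.q _ x)
          (isHomLift_of_eq (GrpObj.left_inv A) inferInstance) }

end Opcleavage

end Inverse

/-! ### The underlying pseudofunctors -/

section Underlying

variable {B : Type u₁} [Category.{v₁} B] [CartesianMonoidalCategory B]
  {E : Type u₂} [Category.{v₂} E] [CartesianMonoidalCategory E]
  {P : E ⥤ B} [IsCartesianMonoidalOpfibration P] (c : Opcleavage P)

/-- Forgetting the monoidal structures on the fibres over internal groups gives back the
pseudofunctor of the cleavage, restricted to internal groups. -/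
theorem grp_comp_monPseudofunctor_comp_forget :
    ((Grp.forget₂Mon B).toPseudofunctor.comp c.monPseudofunctor).comp MonoidalCat.forget =
      (Grp.forget B).toPseudofunctor.comp c.pseudofunctor := by
  refine pseudofunctor_ext_of_isLocallyDiscrete rfl (fun a => heq_of_eq (Iso.ext ?_))
    (fun f g => heq_of_eq (Iso.ext ?_))
  -- Precomposing with a pseudofunctor that comes from an ordinary functor adds to each coherence
  -- isomorphism only the image of an identity 2-cell, removed by `map₂_id`.
  · have h₁ : (((Grp.forget₂Mon B).toPseudofunctor.comp c.monPseudofunctor).mapId a).hom =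
        (c.monPushId a.as.toMon).hom :=
      (congrArg (· ≫ (c.monPushId a.as.toMon).hom) (c.monPseudofunctor.map₂_id _)).trans
        (Category.id_comp _)
    have h₂ : (((Grp.forget B).toPseudofunctor.comp c.pseudofunctor).mapId a).hom =
        NatTrans.toCatHom₂ (c.pushId a.as.X).hom :=
      (congrArg (· ≫ NatTrans.toCatHom₂ (c.pushId a.as.X).hom) (c.pseudofunctor.map₂_id _)).trans
        (Category.id_comp _)
    refine Eq.trans ?_ h₂.symm
    -- The factor dropped here is the identity coherence cell of the strict forgetful 2-functor.
    -- What remains matches definitionally, since `monPushId` is built on `pushId`.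
    refine (Category.comp_id _).trans ?_
    exact congrArg MonoidalCat.forget.map₂ h₁
  · have h₁ : (((Grp.forget₂Mon B).toPseudofunctor.comp c.monPseudofunctor).mapComp f g).hom =
        (c.monPushComp f.as.hom g.as.hom).hom :=
      (congrArg (· ≫ (c.monPushComp f.as.hom g.as.hom).hom) (c.monPseudofunctor.map₂_id _)).trans
        (Category.id_comp _)
    have h₂ : (((Grp.forget B).toPseudofunctor.comp c.pseudofunctor).mapComp f g).hom =
        NatTrans.toCatHom₂ (c.pushComp f.as.hom.hom g.as.hom.hom).hom :=
      (congrArg (· ≫ NatTrans.toCatHom₂ (c.pushComp f.as.hom.hom g.as.hom.hom).hom)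
        (c.pseudofunctor.map₂_id _)).trans
        (Category.id_comp _)
    refine Eq.trans ?_ h₂.symm
    refine (Category.comp_id _).trans ?_
    exact congrArg MonoidalCat.forget.map₂ h₁

/-- Forgetting the symmetric monoidal structures on the fibres over internal abelian groups gives
back the pseudofunctor of the cleavage, restricted to internal abelian groups. -/
theorem commGrp_comp_commMonPseudofunctor_comp_forget [BraidedCategory B] [BraidedCategory E] :
    ((CommGrp.forget₂CommMon B).toPseudofunctor.comp c.commMonPseudofunctor).comp
        SymMonoidalCat.forget =
      (CommGrp.forget B).toPseudofunctor.comp c.pseudofunctor := by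
  refine pseudofunctor_ext_of_isLocallyDiscrete rfl (fun a => heq_of_eq (Iso.ext ?_))
    (fun f g => heq_of_eq (Iso.ext ?_))
  · have h₁ :
        (((CommGrp.forget₂CommMon B).toPseudofunctor.comp c.commMonPseudofunctor).mapId a).hom =
        (c.commMonPushId ((CommGrp.forget₂CommMon B).obj a.as)).hom :=
      (congrArg (· ≫ (c.commMonPushId ((CommGrp.forget₂CommMon B).obj a.as)).hom)
        (c.commMonPseudofunctor.map₂_id _)).trans
        (Category.id_comp _)
    have h₂ : (((CommGrp.forget B).toPseudofunctor.comp c.pseudofunctor).mapId a).hom =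
        NatTrans.toCatHom₂ (c.pushId a.as.X).hom :=
      (congrArg (· ≫ NatTrans.toCatHom₂ (c.pushId a.as.X).hom) (c.pseudofunctor.map₂_id _)).trans
        (Category.id_comp _)
    refine Eq.trans ?_ h₂.symm
    -- Two identity factors occur instead of one, because `SymMonoidalCat.forget` is a composite:
    -- one comes from `MonoidalCat.forget`, the other is the image of an identity of
    -- `toMonoidalCat`.
    refine (congrArg (_ ≫ ·) (Category.comp_id _)).trans ((Category.comp_id _).trans ?_)
    exact congrArg SymMonoidalCat.forget.map₂ h₁
  · have h₁ :
        (((CommGrp.forget₂CommMon B).toPseudofunctor.comp c.commMonPseudofunctor).mapComp f g).hom =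
        (c.commMonPushComp ((CommGrp.forget₂CommMon B).map f.as)
          ((CommGrp.forget₂CommMon B).map g.as)).hom :=
      (congrArg (· ≫ (c.commMonPushComp ((CommGrp.forget₂CommMon B).map f.as)
          ((CommGrp.forget₂CommMon B).map g.as)).hom)
        (c.commMonPseudofunctor.map₂_id _)).trans
        (Category.id_comp _)
    have h₂ : (((CommGrp.forget B).toPseudofunctor.comp c.pseudofunctor).mapComp f g).hom =
        NatTrans.toCatHom₂ (c.pushComp f.as.hom.hom.hom g.as.hom.hom.hom).hom :=
      (congrArg (· ≫ NatTrans.toCatHom₂ (c.pushComp f.as.hom.hom.hom g.as.hom.hom.hom).hom)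
        (c.pseudofunctor.map₂_id _)).trans
        (Category.id_comp _)
    refine Eq.trans ?_ h₂.symm
    refine (congrArg (_ ≫ ·) (Category.comp_id _)).trans ((Category.comp_id _).trans ?_)
    exact congrArg SymMonoidalCat.forget.map₂ h₁

end Underlying

end GroupalOpfib

/-- A cartesian monoidal opfibration `P` whose fibres are groupoids: the associated pseudofunctor
(for any cleavage `c`) lifts to 2-groups on internal groups, and to symmetric 2-groups on internal
abelian groups, the structure on the fibres being the induced one. -/
theorem corollary5p6 {B : Type u₁} [Category.{v₁} B] [CartesianMonoidalCategory B]
    [BraidedCategory B] {E : Type u₂} [Category.{v₂} E] [CartesianMonoidalCategory E]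
    [BraidedCategory E] (P : E ⥤ B) [GroupalOpfib.IsCartesianMonoidalOpfibration P]
    (c : GroupalOpfib.Opcleavage P) (hfib : ∀ A : B, IsGroupoid (P.Fiber A)) :
    (∃ G : Pseudofunctor (LocallyDiscrete (Grp B)) GroupalOpfib.TwoGrp.{v₂, u₂},
      G.comp GroupalOpfib.TwoGrp.forget =
        (Grp.forget B).toPseudofunctor.comp c.pseudofunctor ∧
      G.comp GroupalOpfib.TwoGrp.toMonoidalCat =
        (Grp.forget₂Mon B).toPseudofunctor.comp c.monPseudofunctor) ∧
    (∃ K : Pseudofunctor (LocallyDiscrete (CommGrp B)) GroupalOpfib.SymTwoGrp.{v₂, u₂},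
      K.comp GroupalOpfib.SymTwoGrp.forget =
        (CommGrp.forget B).toPseudofunctor.comp c.pseudofunctor ∧
      K.comp GroupalOpfib.SymTwoGrp.toSymMonoidalCat =
        (CommGrp.forget₂CommMon B).toPseudofunctor.comp c.commMonPseudofunctor) := by
  constructor
  · let G : Pseudofunctor (LocallyDiscrete (Grp B)) GroupalOpfib.TwoGrp.{v₂, u₂} :=
      GroupalOpfib.liftInduced (fun X => GroupalOpfib.IsTwoGroup X.carrier)
        ((Grp.forget₂Mon B).toPseudofunctor.comp c.monPseudofunctor)
        (fun A => c.isTwoGroup_fiber (A := A.as.X) hfib)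
    have hG : G.comp GroupalOpfib.TwoGrp.toMonoidalCat =
        (Grp.forget₂Mon B).toPseudofunctor.comp c.monPseudofunctor :=
      GroupalOpfib.liftInduced_comp_forget _ _ _
    refine ⟨G, ?_, hG⟩
    -- The forgetful 2-functor to categories factors through monoidal categories, so the identity
    -- over `CAT` follows from `hG` and the comparison of underlying pseudofunctors.
    rw [GroupalOpfib.TwoGrp.forget, ← GroupalOpfib.pseudofunctor_comp_assoc, hG]
    exact GroupalOpfib.grp_comp_monPseudofunctor_comp_forget c
  · let K : Pseudofunctor (LocallyDiscrete (CommGrp B)) GroupalOpfib.SymTwoGrp.{v₂, u₂} :=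
      GroupalOpfib.liftInduced (fun X => GroupalOpfib.IsTwoGroup X.carrier)
        ((CommGrp.forget₂CommMon B).toPseudofunctor.comp c.commMonPseudofunctor)
        -- `IsTwoGroup` ignores the symmetry, and the symmetric structure on the fibre extends the
        -- same monoidal structure, so the result for groups applies unchanged.
        (fun A => c.isTwoGroup_fiber (A := A.as.X) hfib)
    have hK : K.comp GroupalOpfib.SymTwoGrp.toSymMonoidalCat =
        (CommGrp.forget₂CommMon B).toPseudofunctor.comp c.commMonPseudofunctor :=
      GroupalOpfib.liftInduced_comp_forget _ _ _
    refine ⟨K, ?_, hK⟩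
    rw [GroupalOpfib.SymTwoGrp.forget, ← GroupalOpfib.pseudofunctor_comp_assoc, hK]
    exact GroupalOpfib.commGrp_comp_commMonPseudofunctor_comp_forget c
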